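/- Let $n\ge 0$ be an integer and let $P$ be a strictly convex polygon in the Euclidean plane with $2n+2$ vertices (for $n=0$, $P$ is the degenerate polygon reduced to a double edge, which has exactly one triangulation, the empty one). A triangulation of $P$ is a decomposition of $P$ into $2n$ non-overlapping triangles (whose vertices are then vertices of $P$). The triangles of a triangulation can be coloured black and white such that edge-adjacent triangles have different colours, and this checkerboard colouring is unique up to exchanging the two colours; the triangulation is called fair if its two colourings involve as many black triangles as white triangles. Then $P$ has exactly $$\binom{2n}{n}^2\frac{1}{n+1}$$ fair triangulations. Moreover, for every choice of a marked edge $e_*$ on the boundary of $P$, this number is the constant term (coefficient of $t^0$) of the Laurent polynomial $$w_{2n}(t)=\sum_{\tau}t^{\,n_b(\tau)-n_w(\tau)}\in\mathbb N[t,t^{-1}],$$ where $\tau$ runs over all triangulations of $P$, and $n_b(\tau)$ and $n_w(\tau)$ are the numbers of black and of white triangles in the checkerboard colouring of $\tau$ in which the triangle containing $e_*$ is black. -/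

import Mathlib

open scoped Finset LaurentPolynomial

namespace FairTriangulation

/-- The Euclidean plane. -/
abbrev Plane : Type := EuclideanSpace ℝ (Fin 2)

/-- `V` is the vertex set of a strictly convex polygon: no vertex lies in the convex hull of other
vertices. The polygon itself is `convexHull ℝ V`. A set of two points is the degenerate polygon
reduced to a (double) edge. -/
def IsStrictlyConvexPolygon (V : Finset Plane) : Prop :=
  2 ≤ #V ∧ ConvexIndependent ℝ ((↑) : V → Plane)

/-- `e` is (the pair of endpoints of) an edge of the polygon with vertex set `V`. -/
def IsEdge (V e : Finset Plane) : Prop :=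
  e ⊆ V ∧ #e = 2 ∧ convexHull ℝ (e : Set Plane) ⊆ frontier (convexHull ℝ (V : Set Plane))

/-- `τ` is a triangulation of the polygon with vertex set `V`: a set of triangles with vertices
in `V`, given by their vertex sets, that do not overlap and whose union is the polygon.
The degenerate polygon with two vertices has the empty set of triangles as its only
triangulation. -/
structure IsTriangulation (V : Finset Plane) (τ : Finset (Finset Plane)) : Prop where
  subset : ∀ s ∈ τ, s ⊆ V
  card_eq : ∀ s ∈ τ, #s = 3
  nonoverlapping : ∀ s ∈ τ, ∀ t ∈ τ, s ≠ t →
    Disjoint (interior (convexHull ℝ (s : Set Plane))) (interior (convexHull ℝ (t : Set Plane)))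
  iUnion_eq : 3 ≤ #V → ⋃ s ∈ τ, convexHull ℝ (s : Set Plane) = convexHull ℝ (V : Set Plane)

open Classical in
/-- Two different triangles are edge-adjacent if they share an edge. -/
def EdgeAdjacent (s t : Finset Plane) : Prop :=
  s ≠ t ∧ #(s ∩ t) = 2

/-- A checkerboard colouring of a set `τ` of triangles is given by the set `B` of black triangles,
the triangles in `τ` outside `B` being white: edge-adjacent triangles have different colours. -/
def IsColouring (τ B : Finset (Finset Plane)) : Prop :=
  B ⊆ τ ∧ ∀ s ∈ τ, ∀ t ∈ τ, EdgeAdjacent s t → (s ∈ B ↔ t ∉ B)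

open Classical in
/-- `τ` has checkerboard colourings, and they have as many black as white triangles. -/
def IsFair (τ : Finset (Finset Plane)) : Prop :=
  (∃ B, IsColouring τ B) ∧ ∀ B, IsColouring τ B → #B = #(τ \ B)

open Classical in
/-- The set of all triangulations of the polygon with vertex set `V`. -/
noncomputable def triangulations (V : Finset Plane) : Finset (Finset (Finset Plane)) :=
  {τ ∈ V.powerset.powerset | IsTriangulation V τ}

open Classical in
/-- The set of all fair triangulations of the polygon with vertex set `V`. -/
noncomputable def fairTriangulations (V : Finset Plane) : Finset (Finset (Finset Plane)) :=
  {τ ∈ triangulations V | IsFair τ}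

open Classical in
/-- The set of all checkerboard triangulations of the polygon with vertex set `V` and marked
edge `e`: pairs of a triangulation and a checkerboard colouring of it (given by its black
triangles) such that the triangle containing the marked edge is black. -/
noncomputable def checkerboardTriangulations (V e : Finset Plane) :
    Finset (Finset (Finset Plane) × Finset (Finset Plane)) :=
  {p ∈ triangulations V ×ˢ V.powerset.powerset |
    IsColouring p.1 p.2 ∧ ∀ s ∈ p.1, e ⊆ s → s ∈ p.2}

open Classical in
/-- The Laurent polynomial `∑ t ^ (n_b - n_w)` over all checkerboard triangulations of the polygon
with vertex set `V` and marked edge `e`, where `n_b` and `n_w` are the numbers of black and of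
white triangles. -/
noncomputable def w (V e : Finset Plane) : ℕ[T;T⁻¹] :=
  ∑ p ∈ checkerboardTriangulations V e,
    LaurentPolynomial.T ((#p.2 : ℤ) - (#(p.1 \ p.2) : ℤ))

end FairTriangulation

-- Number the vertices `v 0, …, v N` counterclockwise, with `N = 2 * n + 1`. In a triangulation,
-- exactly one triangle contains the edge joining `v 0` and `v N`. Its apex `v k` leaves two smaller
-- polygons, on `v 0, …, v k` and on `v k, …, v N`, which are triangulated independently. Iterating
-- identifies triangulations with binary trees having `2 * n` nodes
-- (`isTriangulation_arc_iff_exists_tree`, `dissection_injective`).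
--
-- Edge-adjacent triangles are parent and child in this tree, so the only checkerboard colourings
-- are by parity of depth, and the one with a black root triangle has the even-depth nodes as its
-- black triangles. Hence `w` is the generating polynomial of (even nodes) − (odd nodes), and both
-- its constant term and the number of fair triangulations count trees with `n` nodes at even and
-- `n` at odd depth.
--
-- Removing the root exchanges the parities in the subtrees, so the bivariate series satisfy E = 1 +
-- xO² and O = 1 + yE². With f = E − 1 this reads f = xφ(f), where φ(u) = (1 + y(1 + u)²)², and
-- Lagrange inversion gives the number of trees with a + 1 even and b odd nodes as C(2(a + 1), b)
-- C(2b, a) / (a + 1). The diagonal case is the formula claimed.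
--
-- The geometric input is orientation: signs of `cross` order the vertices, describe polygons as
-- intersections of half-planes, and show that two triangles with crossing chords overlap.

namespace FairTriangulation

-- Lagrange inversion

section Lagrange

open PowerSeries

theorem coeff_pow_eq_zero_of_lt {R : Type*} [CommRing R] {f g : R⟦X⟧} (hf : f = X * g)
    {m k : ℕ} (h : m < k) : coeff m (f ^ k) = 0 := by
  rw [hf, mul_pow, coeff_X_pow_mul']
  simp [h]

/-- Lagrange inversion for polynomial data. -/
theorem lagrange_inversion {R : Type*} [CommRing R] [IsDomain R] [CharZero R] (f : R⟦X⟧)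
    (φ : Polynomial R) (hf : f = X * φ.eval₂ C f) (m : ℕ) :
    ∀ k ≤ m, (m : R) * coeff m (f ^ k) = k * (φ ^ m).coeff (m - k) := by
  induction m with
  | zero => intro k hk; simp [Nat.le_zero.mp hk]
  | succ m ih =>
    intro k hk
    cases k with
    | zero => simp [coeff_one]
    | succ j =>
      have hj : j ≤ m := by omega
      -- A common range for expanding `φ` and for the convolution of coefficients up to degree `m -
      -- j`.
      obtain ⟨M, hM, hM'⟩ : ∃ M, φ.natDegree < M ∧ m + 1 < M :=
        ⟨φ.natDegree + m + 2, by omega, by omega⟩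
      have expand : coeff (m + 1) (f ^ (j + 1)) =
          ∑ i ∈ Finset.range M, φ.coeff i * coeff m (f ^ (j + i)) := by
        have h1 : f ^ (j + 1) = X * (f ^ j * φ.eval₂ C f) := by
          rw [pow_succ, mul_left_comm, ← hf]
        rw [h1, coeff_succ_X_mul, Polynomial.eval₂_eq_sum_range' _ hM,
          Finset.mul_sum, map_sum]
        refine Finset.sum_congr rfl fun i _ => ?_
        rw [mul_left_comm, ← pow_add, PowerSeries.coeff_C_mul]
      -- The induction hypothesis carries a factor `m`, which has to be cancelled later, so `m = 0`
      -- is treated directly.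
      rcases Nat.eq_zero_or_pos m with rfl | hm
      · obtain rfl : j = 0 := by omega
        have : ∑ i ∈ Finset.range M, φ.coeff i * coeff 0 (f ^ (0 + i)) = φ.coeff 0 := by
          rw [Finset.sum_eq_single 0]
          · simp
          · intro i _ hi
            rw [zero_add, coeff_pow_eq_zero_of_lt hf (by omega), mul_zero]
          · simp; omega
        rw [expand, this]
        simp
      have hm0 : (m : R) ≠ 0 := by exact_mod_cast hm.ne'
      have hterm : ∀ i ∈ Finset.range M, (m : R) * (φ.coeff i * coeff m (f ^ (j + i))) =
          if i ≤ m - j then ((j + i : ℕ) : R) * φ.coeff i * (φ ^ m).coeff (m - j - i) else 0 := by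
        intro i _
        split_ifs with h
        · rw [mul_left_comm, ih (j + i) (by omega), Nat.sub_add_eq]
          ring
        · rw [coeff_pow_eq_zero_of_lt hf (by omega)]
          ring
      -- The weights `(j + i) * φ.coeff i` are the coefficients of jφ + Xφ', so the sum is a Cauchy
      -- product with `φ ^ m`.
      have hsum : (m : R) * coeff (m + 1) (f ^ (j + 1)) =
          (((j : Polynomial R) * φ + Polynomial.X * Polynomial.derivative φ) *
            φ ^ m).coeff (m - j) := by
        rw [expand, Finset.mul_sum, Finset.sum_congr rfl hterm, ← Finset.sum_filter,
          Polynomial.coeff_mul, Finset.Nat.sum_antidiagonal_eq_sum_range_succ_mk]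
        have : (Finset.range M).filter (· ≤ m - j) = Finset.range (m - j).succ := by
          ext i; simp; omega
        rw [this]
        refine Finset.sum_congr rfl fun i _ => ?_
        congr 1
        rw [← Polynomial.C_eq_natCast, Polynomial.coeff_add, Polynomial.coeff_C_mul]
        cases i with
        | zero => simp
        | succ i => rw [Polynomial.coeff_X_mul, Polynomial.coeff_derivative]; push_cast; ring
      -- (m + 1)Xφ'φᵐ = X(φᵐ⁺¹)', and X d/dX multiplies the coefficient of degree `m - j` by `m -
      -- j`. The total weight is then (m + 1)j + (m − j) = m(j + 1).
      have hder : ((m : R) + 1) * (Polynomial.X * Polynomial.derivative φ * φ ^ m).coeff (m - j) =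
          ((m : R) - j) * (φ ^ (m + 1)).coeff (m - j) := by
        have h1 : Polynomial.C ((m : R) + 1) * (Polynomial.X * Polynomial.derivative φ * φ ^ m) =
            Polynomial.X * Polynomial.derivative (φ ^ (m + 1)) := by
          rw [Polynomial.derivative_pow_succ]; ring
        rw [← Polynomial.coeff_C_mul, h1]
        obtain ⟨d, hd⟩ : ∃ d, m = j + d := ⟨m - j, by omega⟩
        rw [show m - j = d by omega, show (m : R) - j = d by rw [hd]; push_cast; ring]
        cases d with
        | zero => simp
        | succ d => rw [Polynomial.coeff_X_mul, Polynomial.coeff_derivative]; push_cast; ring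
      have hsplit : (((j : Polynomial R) * φ + Polynomial.X * Polynomial.derivative φ) *
            φ ^ m).coeff (m - j) = j * (φ ^ (m + 1)).coeff (m - j) +
            (Polynomial.X * Polynomial.derivative φ * φ ^ m).coeff (m - j) := by
        rw [add_mul, Polynomial.coeff_add, ← Polynomial.C_eq_natCast, mul_assoc,
          Polynomial.coeff_C_mul, ← pow_succ']
      apply mul_left_cancel₀ hm0
      rw [Nat.add_sub_add_right]
      push_cast
      linear_combination ((m : R) + 1) * hsum + ((m : R) + 1) * hsplit + hder

theorem eval₂_one_add_sq_sq {R : Type*} [CommRing R] (f : R⟦X⟧) (c : R) :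
    ((1 + Polynomial.C c * (1 + Polynomial.X) ^ 2) ^ 2).eval₂ C f =
      (1 + C c * (1 + f) ^ 2) ^ 2 := by
  simp [Polynomial.eval₂_pow]

end Lagrange

-- Binary trees counted by parity of depth

section Trees

open BinaryTree

mutual
/-- The number of nodes at even depth. -/
def evenNodes : BinaryTree Unit → ℕ
  | .nil => 0
  | .node _ l r => oddNodes l + oddNodes r + 1
/-- The number of nodes at odd depth. -/
def oddNodes : BinaryTree Unit → ℕ
  | .nil => 0
  | .node _ l r => evenNodes l + evenNodes r
end

theorem evenNodes_add_oddNodes (t : BinaryTree Unit) : evenNodes t + oddNodes t = t.numNodes := by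
  induction t with
  | nil => simp [evenNodes, oddNodes]
  | node _ l r hl hr => simp only [evenNodes, oddNodes, numNodes]; omega

/-- The binary trees with `a` nodes at even depth and `b` nodes at odd depth. -/
def bicolouredTrees (a b : ℕ) : Finset (BinaryTree Unit) :=
  {t ∈ treesOfNumNodesEq (a + b) | evenNodes t = a ∧ oddNodes t = b}

theorem mem_bicolouredTrees {a b : ℕ} {t : BinaryTree Unit} :
    t ∈ bicolouredTrees a b ↔ evenNodes t = a ∧ oddNodes t = b := by
  have := evenNodes_add_oddNodes t
  simp only [bicolouredTrees, Finset.mem_filter, mem_treesOfNumNodesEq]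
  omega

theorem card_bicolouredTrees_zero_left (b : ℕ) :
    #(bicolouredTrees 0 b) = if b = 0 then 1 else 0 := by
  have : bicolouredTrees 0 b = if b = 0 then {.nil} else ∅ := by
    ext t
    rw [mem_bicolouredTrees]
    cases t <;> split_ifs <;> simp [evenNodes, oddNodes] <;> omega
  rw [this]
  split_ifs <;> simp

/-- Deleting the root shifts all depths by one: the `b` odd nodes become the even nodes of the two
subtrees and the `a` remaining even nodes become odd. This is why `q` precedes `p` on the right. -/
theorem card_bicolouredTrees_succ_left (a b : ℕ) :
    #(bicolouredTrees (a + 1) b) = ∑ p ∈ Finset.HasAntidiagonal.antidiagonal a, ∑ q ∈ Finset.HasAntidiagonal.antidiagonal b,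
      #(bicolouredTrees q.1 p.1) * #(bicolouredTrees q.2 p.2) := by
  have : bicolouredTrees (a + 1) b =
      (Finset.HasAntidiagonal.antidiagonal a ×ˢ Finset.HasAntidiagonal.antidiagonal b).biUnion fun x =>
        pairwiseNode (bicolouredTrees x.2.1 x.1.1) (bicolouredTrees x.2.2 x.1.2) := by
    ext t
    rw [mem_bicolouredTrees]
    cases t with
    | nil => simp [evenNodes]
    | node u l r =>
      simp only [Finset.mem_biUnion, Finset.mem_product, Finset.HasAntidiagonal.mem_antidiagonal, Finset.mem_map,
        Prod.exists, mem_bicolouredTrees, evenNodes, oddNodes]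
      constructor
      · rintro ⟨h1, h2⟩
        exact ⟨oddNodes l, oddNodes r, evenNodes l, evenNodes r, ⟨by omega, h2⟩, l, r,
          ⟨⟨rfl, rfl⟩, rfl, rfl⟩, rfl⟩
      · rintro ⟨a1, a2, b1, b2, ⟨h1, h2⟩, l', r', ⟨⟨h3, h4⟩, h5, h6⟩, h⟩
        injection h with _ hl hr
        subst hl hr
        dsimp only at *
        omega
  rw [this, Finset.card_biUnion]
  · rw [Finset.sum_product]
    simp [Finset.card_map, Finset.card_product]
  · rintro ⟨⟨a1, a2⟩, b1, b2⟩ _ ⟨⟨c1, c2⟩, d1, d2⟩ _ hne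
    rw [Function.onFun, Finset.disjoint_left]
    intro t h1 h2
    simp only [Finset.mem_map, Finset.mem_product, mem_bicolouredTrees, Prod.exists] at h1 h2
    obtain ⟨l, r, ⟨⟨e1, e2⟩, e3, e4⟩, rfl⟩ := h1
    obtain ⟨l', r', ⟨⟨e5, e6⟩, e7, e8⟩, h⟩ := h2
    injection h with _ hl hr
    subst hl hr
    apply hne
    dsimp only at *
    simp only [Prod.mk.injEq]
    omega

open PowerSeries

/-- The bivariate generating series of binary trees by numbers of nodes at even depth (outer
variable) and at odd depth (inner variable). -/
noncomputable def evenSeries : ℚ⟦X⟧⟦X⟧ :=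
  PowerSeries.mk fun a => PowerSeries.mk fun b => (#(bicolouredTrees a b) : ℚ)

/-- The generating series `evenSeries` with the two variables exchanged. -/
noncomputable def oddSeries : ℚ⟦X⟧⟦X⟧ :=
  PowerSeries.mk fun a => PowerSeries.mk fun b => (#(bicolouredTrees b a) : ℚ)

theorem evenSeries_eq : evenSeries = 1 + X * oddSeries ^ 2 := by
  ext a b
  cases a with
  | zero =>
    simp [evenSeries, card_bicolouredTrees_zero_left, PowerSeries.coeff_one]
  | succ a =>
    rw [map_add, coeff_succ_X_mul, sq, PowerSeries.coeff_mul, PowerSeries.coeff_one]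
    simp [evenSeries, oddSeries, PowerSeries.coeff_mul, card_bicolouredTrees_succ_left]

theorem oddSeries_eq : oddSeries = 1 + C X * evenSeries ^ 2 := by
  ext a b
  rw [map_add, PowerSeries.coeff_C_mul, map_add]
  cases b with
  | zero =>
    simp only [oddSeries, coeff_mk, card_bicolouredTrees_zero_left, coeff_zero_X_mul,
      PowerSeries.coeff_one]
    split_ifs <;> simp [PowerSeries.coeff_one]
  | succ b =>
    rw [coeff_succ_X_mul, sq, PowerSeries.coeff_mul, PowerSeries.coeff_one]
    simp only [evenSeries, oddSeries, coeff_mk, card_bicolouredTrees_succ_left, map_sum,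
      PowerSeries.coeff_mul]
    rw [Finset.sum_comm]
    split_ifs <;> simp [PowerSeries.coeff_one]

/-- Lagrange inversion in the outer variable, over power series in the inner one, with exponent `k =
1`. The right side is the coefficient of uᵃyᵇ in (1 + y(1 + u)²)^(2(a + 1)). -/
theorem card_bicolouredTrees_succ_succ (a b : ℕ) :
    ((a : ℚ) + 1) * #(bicolouredTrees (a + 1) b) =
      (2 * (a + 1)).choose b * (2 * b).choose a := by
  set φ : Polynomial ℚ⟦X⟧ := (1 + Polynomial.C X * (1 + Polynomial.X) ^ 2) ^ 2 with hφ
  have hf : evenSeries - 1 = X * φ.eval₂ C (evenSeries - 1) := by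
    have : φ.eval₂ C (evenSeries - 1) = oddSeries ^ 2 := by
      rw [oddSeries_eq, hφ, eval₂_one_add_sq_sq, add_sub_cancel]
    rw [this, sub_eq_iff_eq_add', ← evenSeries_eq]
  have : CharZero ℚ⟦X⟧ := algebraRat.charZero ℚ⟦X⟧
  have key := lagrange_inversion _ φ hf (a + 1) 1 (by omega)
  rw [pow_one, Nat.add_sub_cancel, hφ, ← pow_mul, add_comm (1 : Polynomial _), add_pow,
    Polynomial.finsetSum_coeff] at key
  have key2 := congrArg (PowerSeries.coeff b) key
  -- The `i`-th binomial term carries the inner variable to the power `i` exactly, so only `i = b`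
  -- survives.
  have hterm : ∀ i, PowerSeries.coeff b (((Polynomial.C X * (1 + Polynomial.X) ^ 2) ^ i *
      1 ^ (2 * (a + 1) - i) * ((2 * (a + 1)).choose i : Polynomial ℚ⟦X⟧)).coeff a) =
      if i = b then ((2 * (a + 1)).choose b * (2 * b).choose a : ℚ) else 0 := by
    intro i
    rw [one_pow, mul_one, mul_pow, ← pow_mul, ← Polynomial.C_pow, mul_assoc,
      Polynomial.coeff_C_mul, ← Polynomial.C_eq_natCast, Polynomial.coeff_mul_C,
      Polynomial.coeff_one_add_X_pow, coeff_X_pow_mul', ← Nat.cast_mul]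
    have hc : ∀ m : ℕ, (m : ℚ⟦X⟧) = C (m : ℚ) := fun m => by simp
    rw [hc, PowerSeries.coeff_C]
    split_ifs with h1 h2 h3 h4
    · subst h3; push_cast; ring
    · omega
    · omega
    · rfl
    · omega
    · rfl
  rw [Nat.cast_one, one_mul, map_sum, Finset.sum_congr rfl fun i _ => hterm i,
    Finset.sum_ite_eq'] at key2
  have hl : PowerSeries.coeff b (((a + 1 : ℕ) : ℚ⟦X⟧) * PowerSeries.coeff (a + 1)
      (evenSeries - 1)) = ((a : ℚ) + 1) * #(bicolouredTrees (a + 1) b) := by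
    have hc : ((a + 1 : ℕ) : ℚ⟦X⟧) = C ((a : ℚ) + 1) := by simp
    rw [hc, PowerSeries.coeff_C_mul, map_sub, PowerSeries.coeff_one]
    simp [evenSeries]
  rw [← hl, key2]
  -- If `b` exceeds the exponent, there is no term `i = b`, in accordance with the vanishing
  -- binomial coefficient.
  split_ifs with h
  · rfl
  · rw [Nat.choose_eq_zero_of_lt (by simpa using h)]; simp

/-- The number of binary trees with `n` nodes at even depth and `n` nodes at odd depth. -/
theorem card_bicolouredTrees_self (n : ℕ) :
    (#(bicolouredTrees n n) : ℚ) = ((2 * n).choose n : ℚ) ^ 2 / ((n : ℚ) + 1) := by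
  cases n with
  | zero => simp [card_bicolouredTrees_zero_left]
  | succ n =>
    have h1 := card_bicolouredTrees_succ_succ n (n + 1)
    have h2 : ((2 * (n + 1)).choose (n + 1) : ℚ) * (n + 1) =
        (2 * (n + 1)).choose n * (n + 2) := by
      have := Nat.choose_succ_right_eq (2 * (n + 1)) n
      rw [show 2 * (n + 1) - n = n + 2 by omega] at this
      exact_mod_cast this
    have h0 : ((n : ℚ) + 1) ≠ 0 := by positivity
    have h3 : ((n : ℚ) + 1 + 1) ≠ 0 := by positivity
    push_cast
    rw [eq_div_iff h3]
    apply mul_left_cancel₀ h0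
    linear_combination (n + 1 + 1 : ℚ) * h1 - ((2 * (n + 1)).choose (n + 1) : ℚ) * h2

end Trees

-- Orientation and convexity in the plane

section Plane

open Topology

/-- Twice the signed area of the triangle `a b c`. -/
def cross (a b c : Plane) : ℝ := (b 0 - a 0) * (c 1 - a 1) - (b 1 - a 1) * (c 0 - a 0)

theorem cross_rotate (a b c : Plane) : cross b c a = cross a b c := by
  simp only [cross]; ring

theorem cross_swap (a b c : Plane) : cross b a c = -cross a b c := by
  simp only [cross]; ring

theorem cross_self_left (a c : Plane) : cross a a c = 0 := by
  simp only [cross]; ring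

theorem cross_self_right (a b : Plane) : cross a b b = 0 := by
  simp only [cross]; ring

theorem cross_self_outer (a b : Plane) : cross a b a = 0 := by
  simp only [cross]; ring

theorem cross_combo (a b x y : Plane) {s t : ℝ} (h : s + t = 1) :
    cross a b (s • x + t • y) = s * cross a b x + t * cross a b y := by
  obtain rfl : t = 1 - s := by linarith
  simp only [cross, PiLp.add_apply, PiLp.smul_apply, smul_eq_mul]; ring

theorem cross_add_smul_sub (a b c x : Plane) (s : ℝ) :
    cross a b (x + s • (c - a)) = cross a b x + s * cross a b c := by
  simp only [cross, PiLp.add_apply, PiLp.smul_apply, PiLp.sub_apply, smul_eq_mul]; ring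

theorem continuous_cross (a b : Plane) : Continuous (cross a b) := by
  unfold cross; fun_prop

theorem convex_cross_nonneg (a b : Plane) : Convex ℝ {x | 0 ≤ cross a b x} := by
  intro x hx y hy s t hs ht hst
  simp only [Set.mem_ofPred_eq] at *
  rw [cross_combo a b x y hst]
  positivity

theorem cross_nonneg_of_mem_convexHull {a b : Plane} {S : Set Plane}
    (h : ∀ y ∈ S, 0 ≤ cross a b y) {x : Plane} (hx : x ∈ convexHull ℝ S) : 0 ≤ cross a b x :=
  convexHull_min (s := S) h (convex_cross_nonneg a b) hx

theorem cross_sum (a b c x : Plane) :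
    cross b c x + cross c a x + cross a b x = cross a b c := by
  simp only [cross]; ring

/-- Barycentric coordinates cleared of denominators; `cross_sum` says that they have the right total
weight. -/
theorem cross_smul_eq (a b c x : Plane) :
    cross a b c • x = cross b c x • a + cross c a x • b + cross a b x • c := by
  ext i
  fin_cases i <;>
  · simp only [cross, PiLp.add_apply, PiLp.smul_apply, smul_eq_mul, Fin.zero_eta, Fin.mk_one]
    ring

theorem mem_convexHull_triangle {a b c x : Plane} (h : 0 < cross a b c) (hab : 0 ≤ cross a b x)
    (hbc : 0 ≤ cross b c x) (hca : 0 ≤ cross c a x) :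
    x ∈ convexHull ℝ ({a, b, c} : Set Plane) := by
  have hx : x = (cross b c x / cross a b c) • a + (cross c a x / cross a b c) • b +
      (cross a b x / cross a b c) • c := by
    have := congrArg (fun y => (cross a b c)⁻¹ • y) (cross_smul_eq a b c x)
    simp only [smul_add, smul_smul, inv_mul_cancel₀ h.ne', one_smul] at this
    simpa only [div_eq_inv_mul] using this
  rw [convexHull_insert (Set.insert_nonempty _ _), convexHull_pair, mem_convexJoin]
  have hsum := cross_sum a b c x
  -- The point on the side `b c` collinear with `a` and `x` is found by normalising the weights of
  -- `b` and `c`, which fails only for `x = a`.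
  by_cases hb : cross c a x + cross a b x = 0
  · have h1 : cross c a x = 0 := by linarith
    have h2 : cross a b x = 0 := by linarith
    refine ⟨a, rfl, b, left_mem_segment ℝ b c, ?_⟩
    have : x = a := by
      rw [h1, h2, show cross b c x = cross a b c by linarith, div_self h.ne'] at hx
      simpa using hx
    rw [this]
    exact left_mem_segment ℝ a b
  · have hpos : 0 < cross c a x + cross a b x := lt_of_le_of_ne (by positivity) (Ne.symm hb)
    refine ⟨a, rfl, (cross c a x / (cross c a x + cross a b x)) • b +
      (cross a b x / (cross c a x + cross a b x)) • c,
      ⟨_, _, by positivity, by positivity, by field_simp, rfl⟩,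
      cross b c x / cross a b c, (cross c a x + cross a b x) / cross a b c,
      by positivity, by positivity, by rw [← add_div, ← add_assoc, hsum, div_self h.ne'], ?_⟩
    conv_rhs => rw [hx]
    rw [smul_add, smul_smul, smul_smul, add_assoc]
    congr 3 <;> field_simp

theorem interior_convexHull_triangle_nonempty {a b c : Plane} (h : 0 < cross a b c) {S : Set Plane}
    (hS : {a, b, c} ⊆ S) : (interior (convexHull ℝ S)).Nonempty := by
  have hsub : {x | 0 < cross a b x ∧ 0 < cross b c x ∧ 0 < cross c a x} ⊆ convexHull ℝ S :=
    fun x hx => convexHull_mono hS (mem_convexHull_triangle h hx.1.le hx.2.1.le hx.2.2.le)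
  have hopen : IsOpen {x | 0 < cross a b x ∧ 0 < cross b c x ∧ 0 < cross c a x} :=
    (isOpen_lt continuous_const (continuous_cross a b)).inter
      ((isOpen_lt continuous_const (continuous_cross b c)).inter
        (isOpen_lt continuous_const (continuous_cross c a)))
  refine ⟨(1 / 3 : ℝ) • (a + b + c), interior_maximal hsub hopen ?_⟩
  simp only [cross, PiLp.add_apply, PiLp.smul_apply, smul_eq_mul, Set.mem_ofPred_eq] at *
  refine ⟨?_, ?_, ?_⟩ <;> nlinarith

theorem exists_pos_add_smul_mem {U : Set Plane} (hU : IsOpen U) {p : Plane} (hp : p ∈ U)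
    (d : Plane) : ∃ s : ℝ, 0 < s ∧ p + s • d ∈ U := by
  have hc : Continuous fun s : ℝ => p + s • d := by fun_prop
  have : ∀ᶠ s in 𝓝[>] (0 : ℝ), p + s • d ∈ U :=
    (hc.continuousAt.eventually_mem (hU.mem_nhds (by simpa using hp))).filter_mono
      nhdsWithin_le_nhds
  obtain ⟨s, hs, hs'⟩ := (this.and self_mem_nhdsWithin).exists
  exact ⟨s, hs', hs⟩

/-- A common interior point would lie on the line through `a` and `b`, and so would all nearby
points; but a small move in direction `c - a` leaves that line. -/
theorem disjoint_interior_of_cross {a b c : Plane} (hc : cross a b c ≠ 0) {S T : Set Plane}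
    (hS : ∀ x ∈ S, 0 ≤ cross a b x) (hT : ∀ x ∈ T, cross a b x ≤ 0) :
    Disjoint (interior (convexHull ℝ S)) (interior (convexHull ℝ T)) := by
  rw [Set.disjoint_left]
  intro p hpS hpT
  have h0 : ∀ x ∈ interior (convexHull ℝ S) ∩ interior (convexHull ℝ T), cross a b x = 0 := by
    intro x hx
    have h1 := cross_nonneg_of_mem_convexHull hS (interior_subset hx.1)
    have h2 := cross_nonneg_of_mem_convexHull (a := b) (b := a) (S := T)
      (fun y hy => by rw [cross_swap]; linarith [hT y hy]) (interior_subset hx.2)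
    rw [cross_swap] at h2
    linarith
  obtain ⟨s, hs, hmem⟩ := exists_pos_add_smul_mem (isOpen_interior.inter isOpen_interior)
    (p := p) ⟨hpS, hpT⟩ (c - a)
  have h1 := h0 _ hmem
  rw [cross_add_smul_sub, h0 p ⟨hpS, hpT⟩, zero_add] at h1
  rcases mul_eq_zero.mp h1 with h | h
  · exact hs.ne' h
  · exact hc h

theorem continuousLinearMap_const_of_cross (f : Plane →L[ℝ] ℝ) {a b c : Plane} {u : ℝ}
    (h : cross a b c ≠ 0) (ha : f a = u) (hb : f b = u) (hc : f c = u) (x : Plane) : f x = u := by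
  have h1 := congrArg f (cross_smul_eq a b c x)
  simp only [map_add, map_smul, smul_eq_mul, ha, hb, hc] at h1
  have h2 := cross_sum a b c x
  apply mul_left_cancel₀ h
  rw [h1, ← h2]
  ring

/-- The diagonals `p r` and `q t` of a convex quadrilateral cross. A line separating the two
interiors would weakly separate the diagonals, hence contain their common point and then all four
vertices, which are not collinear. -/
theorem not_disjoint_interior_of_crossing {p q r t : Plane} (hpqr : 0 < cross p q r)
    (hqrt : 0 < cross q r t) (hpqt : 0 < cross p q t) (hprt : 0 < cross p r t) {S T : Set Plane}
    (hp : p ∈ S) (hr : r ∈ S) (hq : q ∈ T) (ht : t ∈ T)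
    (hS : (interior (convexHull ℝ S)).Nonempty) (hT : (interior (convexHull ℝ T)).Nonempty) :
    ¬Disjoint (interior (convexHull ℝ S)) (interior (convexHull ℝ T)) := by
  intro hd
  have hcS := convex_convexHull ℝ S
  have hcT := convex_convexHull ℝ T
  obtain ⟨f, u, hfS, hfT⟩ := geometric_hahn_banach_open_open hcS.interior isOpen_interior
    hcT.interior isOpen_interior hd
  have hS' : ∀ x ∈ S, f x ≤ u := by
    intro x hx
    have : x ∈ closure (interior (convexHull ℝ S)) := by
      rw [hcS.closure_interior_eq_closure_of_nonempty_interior hS]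
      exact subset_closure (subset_convexHull ℝ S hx)
    exact closure_minimal (fun y hy => (hfS y hy).le)
      (isClosed_le f.continuous continuous_const) this
  have hT' : ∀ x ∈ T, u ≤ f x := by
    intro x hx
    have : x ∈ closure (interior (convexHull ℝ T)) := by
      rw [hcT.closure_interior_eq_closure_of_nonempty_interior hT]
      exact subset_closure (subset_convexHull ℝ T hx)
    exact closure_minimal (fun y hy => (hfT y hy).le)
      (isClosed_le continuous_const f.continuous) this
  -- Both sides are the crossing point of the diagonals, scaled by the common total weight of
  -- `hid2`. Applying `f`, a weighted average of values `≤ u` equals one of values `≥ u`, so all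
  -- four values are `u`.
  have hid : cross q r t • p + cross p q t • r = cross p r t • q + cross p q r • t := by
    ext i
    fin_cases i <;>
    · simp only [cross, PiLp.add_apply, PiLp.smul_apply, smul_eq_mul, Fin.zero_eta, Fin.mk_one]
      ring
  have hid2 : cross q r t + cross p q t = cross p r t + cross p q r := by
    simp only [cross]; ring
  have hf := congrArg f hid
  simp only [map_add, map_smul, smul_eq_mul] at hf
  have e1 : 0 ≤ cross q r t * (u - f p) := mul_nonneg hqrt.le (by linarith [hS' p hp])
  have e2 : 0 ≤ cross p q t * (u - f r) := mul_nonneg hpqt.le (by linarith [hS' r hr])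
  have e3 : 0 ≤ cross p r t * (f q - u) := mul_nonneg hprt.le (by linarith [hT' q hq])
  have e4 : 0 ≤ cross p q r * (f t - u) := mul_nonneg hpqr.le (by linarith [hT' t ht])
  have hu : cross q r t * u + cross p q t * u = cross p r t * u + cross p q r * u := by
    rw [← add_mul, ← add_mul, hid2]
  have z1 : cross q r t * (u - f p) = 0 := by nlinarith
  have z2 : cross p q t * (u - f r) = 0 := by nlinarith
  have z3 : cross p r t * (f q - u) = 0 := by nlinarith
  have hp' : f p = u := by
    have := (mul_eq_zero.mp z1).resolve_left hqrt.ne'; linarith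
  have hr' : f r = u := by
    have := (mul_eq_zero.mp z2).resolve_left hpqt.ne'; linarith
  have hq' : f q = u := by
    have := (mul_eq_zero.mp z3).resolve_left hprt.ne'; linarith
  obtain ⟨y, hy⟩ := hS
  have := hfS y hy
  rw [continuousLinearMap_const_of_cross f hpqr.ne' hp' hq' hr' y] at this
  exact lt_irrefl _ this

/-- A closed set which contains the part of a convex set strictly on one side of a supporting
line contains the whole convex set, provided that part is non-empty. -/
theorem Convex.subset_of_cross_pos_subset {A C : Set Plane} (hA : Convex ℝ A) (hC : IsClosed C)
    {a b y : Plane} (hy : y ∈ A) (hy' : 0 < cross a b y) (hA' : ∀ x ∈ A, 0 ≤ cross a b x)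
    (h : ∀ x ∈ A, 0 < cross a b x → x ∈ C) : A ⊆ C := by
  intro x hx
  have hc : Continuous fun s : ℝ => (1 - s) • x + s • y := by fun_prop
  -- Points on the segment from `x` towards `y` are strictly on the positive side, and they converge
  -- to `x`.
  have ht : Filter.Tendsto (fun s : ℝ => (1 - s) • x + s • y) (𝓝[>] 0) (𝓝 x) := by
    have := hc.tendsto 0
    simp only [sub_zero, one_smul, zero_smul, add_zero] at this
    exact this.mono_left nhdsWithin_le_nhds
  refine hC.mem_of_tendsto ht ?_
  filter_upwards [Ioo_mem_nhdsGT (zero_lt_one' ℝ)] with s hs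
  refine h _ (hA hx hy (by linarith [hs.2]) hs.1.le (by ring)) ?_
  rw [cross_combo a b x y (by ring)]
  have h1 := mul_nonneg (by linarith [hs.2] : 0 ≤ 1 - s) (hA' x hx)
  have h2 := mul_pos hs.1 hy'
  linarith

end Plane

-- Polygons on consecutive vertices and their triangulations

section Arc

/-- The points `v 0, …, v N` are in counterclockwise convex position. -/
def IsCounterclockwise (v : ℕ → Plane) (N : ℕ) : Prop :=
  ∀ i j k, i < j → j < k → k ≤ N → 0 < cross (v i) (v j) (v k)

open Classical in
/-- The points `v i, …, v j`. -/
noncomputable def arc (v : ℕ → Plane) (i j : ℕ) : Finset Plane := (Finset.Icc i j).image v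

variable {v : ℕ → Plane} {N : ℕ}

theorem mem_arc {i j : ℕ} {x : Plane} : x ∈ arc v i j ↔ ∃ l, i ≤ l ∧ l ≤ j ∧ v l = x := by
  simp [arc, and_assoc]

theorem apply_mem_arc {i j l : ℕ} (h1 : i ≤ l) (h2 : l ≤ j) : v l ∈ arc v i j :=
  mem_arc.mpr ⟨l, h1, h2, rfl⟩

theorem arc_subset_arc {i j i' j' : ℕ} (h1 : i' ≤ i) (h2 : j ≤ j') : arc v i j ⊆ arc v i' j' := by
  classical
  exact Finset.image_subset_image (Finset.Icc_subset_Icc h1 h2)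

theorem IsCounterclockwise.cross_nonneg (hv : IsCounterclockwise v N) {i j k : ℕ} (hij : i ≤ j)
    (hjk : j ≤ k) (hk : k ≤ N) : 0 ≤ cross (v i) (v j) (v k) := by
  rcases hij.eq_or_lt with rfl | hij
  · rw [cross_self_left]
  rcases hjk.eq_or_lt with rfl | hjk
  · rw [cross_self_right]
  exact (hv i j k hij hjk hk).le

theorem IsCounterclockwise.ne_of_lt (hv : IsCounterclockwise v N) (hN : 2 ≤ N) {i j : ℕ}
    (hij : i < j) (hj : j ≤ N) : v i ≠ v j := by
  intro h
  rcases Nat.lt_or_ge j N with hjN | hjN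
  · have := hv i j N hij hjN le_rfl
    rw [h, cross_self_left] at this
    exact lt_irrefl _ this
  · rcases Nat.eq_zero_or_pos i with rfl | hi
    · have := hv 0 1 j (by omega) (by omega) hj
      rw [h, cross_self_outer] at this
      exact lt_irrefl _ this
    · have := hv 0 i j hi hij hj
      rw [h, cross_self_right] at this
      exact lt_irrefl _ this

theorem IsCounterclockwise.injOn (hv : IsCounterclockwise v N) (hN : 2 ≤ N) :
    Set.InjOn v (Set.Iic N) := by
  intro i hi j hj h
  simp only [Set.mem_Iic] at hi hj
  by_contra hne
  rcases Nat.lt_or_gt_of_ne hne with hlt | hlt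
  · exact hv.ne_of_lt hN hlt hj h
  · exact hv.ne_of_lt hN hlt hi h.symm

theorem IsCounterclockwise.eq_of_apply_eq (hv : IsCounterclockwise v N) (hN : 2 ≤ N) {i j : ℕ}
    (hi : i ≤ N) (hj : j ≤ N) (h : v i = v j) : i = j :=
  hv.injOn hN hi hj h

theorem IsCounterclockwise.apply_mem_arc_iff (hv : IsCounterclockwise v N) (hN : 2 ≤ N)
    {i j l : ℕ} (hl : l ≤ N) (hj : j ≤ N) : v l ∈ arc v i j ↔ i ≤ l ∧ l ≤ j := by
  rw [mem_arc]
  constructor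
  · rintro ⟨m, h1, h2, h3⟩
    obtain rfl := hv.eq_of_apply_eq hN (h2.trans hj) hl h3
    exact ⟨h1, h2⟩
  · rintro ⟨h1, h2⟩
    exact ⟨l, h1, h2, rfl⟩

theorem IsCounterclockwise.card_arc (hv : IsCounterclockwise v N) (hN : 2 ≤ N) {i j : ℕ}
    (hj : j ≤ N) : #(arc v i j) = j + 1 - i := by
  classical
  rw [arc, Finset.card_image_of_injOn, Nat.card_Icc]
  refine (hv.injOn hN).mono fun l hl => ?_
  simp only [Finset.coe_Icc, Set.mem_Icc] at hl
  exact hl.2.trans hj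

open Classical in
/-- The triangle with vertices `v x, v y, v z`. -/
noncomputable def triangle (v : ℕ → Plane) (x y z : ℕ) : Finset Plane := {v x, v y, v z}

theorem mem_triangle {x y z : ℕ} {p : Plane} :
    p ∈ triangle v x y z ↔ p = v x ∨ p = v y ∨ p = v z := by
  simp [triangle]

theorem coe_triangle (x y z : ℕ) : (triangle v x y z : Set Plane) = {v x, v y, v z} := by
  simp [triangle]

theorem IsCounterclockwise.card_triangle (hv : IsCounterclockwise v N) {x y z : ℕ}
    (hxy : x < y) (hyz : y < z) (hz : z ≤ N) : #(triangle v x y z) = 3 := by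
  classical
  rw [triangle, Finset.card_eq_three]
  have hN : 2 ≤ N := by omega
  exact ⟨_, _, _, hv.ne_of_lt hN hxy (by omega), hv.ne_of_lt hN (hxy.trans hyz) hz,
    hv.ne_of_lt hN hyz hz, rfl⟩

theorem triangle_subset_arc {x y z i j : ℕ} (hix : i ≤ x) (hxy : x ≤ y) (hyz : y ≤ z)
    (hzj : z ≤ j) : triangle v x y z ⊆ arc v i j := by
  intro p hp
  rcases mem_triangle.mp hp with rfl | rfl | rfl <;> apply apply_mem_arc <;> omega

theorem exists_triangle_eq {i j : ℕ} {s : Finset Plane} (hs : s ⊆ arc v i j) (hs3 : #s = 3) :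
    ∃ x y z, i ≤ x ∧ x < y ∧ y < z ∧ z ≤ j ∧ s = triangle v x y z := by
  classical
  obtain ⟨a, b, c, hab, hac, hbc, rfl⟩ := Finset.card_eq_three.mp hs3
  obtain ⟨x, hx1, hx2, rfl⟩ := mem_arc.mp (hs (by simp : a ∈ _))
  obtain ⟨y, hy1, hy2, rfl⟩ := mem_arc.mp (hs (by simp : b ∈ _))
  obtain ⟨z, hz1, hz2, rfl⟩ := mem_arc.mp (hs (by simp : c ∈ _))
  have h1 : x ≠ y := fun h => hab (by rw [h])
  have h2 : x ≠ z := fun h => hac (by rw [h])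
  have h3 : y ≠ z := fun h => hbc (by rw [h])
  rcases lt_or_gt_of_ne h1 with h1 | h1 <;> rcases lt_or_gt_of_ne h2 with h2 | h2 <;>
    rcases lt_or_gt_of_ne h3 with h3 | h3
  · exact ⟨x, y, z, hx1, h1, h3, hz2, by ext; simp [triangle]⟩
  · exact ⟨x, z, y, hx1, h2, h3, hy2, by ext; simp [triangle]; tauto⟩
  · omega
  · exact ⟨z, x, y, hz1, h2, h1, hy2, by ext; simp [triangle]; tauto⟩
  · exact ⟨y, x, z, hy1, h1, h2, hz2, by ext; simp [triangle]; tauto⟩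
  · omega
  · exact ⟨y, z, x, hy1, h3, h2, hx2, by ext; simp [triangle]; tauto⟩
  · exact ⟨z, y, x, hz1, h3, h1, hx2, by ext; simp [triangle]; tauto⟩

theorem IsCounterclockwise.cross_edge_nonneg (hv : IsCounterclockwise v N) {i j m : ℕ}
    (hj : j ≤ N) (hmj : m < j) {x : Plane}
    (hx : x ∈ convexHull ℝ (arc v i j : Set Plane)) : 0 ≤ cross (v m) (v (m + 1)) x := by
  refine cross_nonneg_of_mem_convexHull (fun y hy => ?_) hx
  obtain ⟨l, hl1, hl2, rfl⟩ := mem_arc.mp hy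
  rcases Nat.lt_or_ge m l with h | h
  · exact hv.cross_nonneg (by omega) h (by omega)
  · rw [cross_rotate]
    exact hv.cross_nonneg h (by omega) (by omega)

theorem IsCounterclockwise.cross_chord_nonneg (hv : IsCounterclockwise v N) {i j : ℕ}
    (hj : j ≤ N) {x : Plane} (hx : x ∈ convexHull ℝ (arc v i j : Set Plane)) :
    0 ≤ cross (v j) (v i) x := by
  refine cross_nonneg_of_mem_convexHull (fun y hy => ?_) hx
  obtain ⟨l, hl1, hl2, rfl⟩ := mem_arc.mp hy
  rw [← cross_rotate]
  exact hv.cross_nonneg hl1 hl2 hj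

/-- A convex polygon is the intersection of the half-planes bounded by its edges. -/
theorem IsCounterclockwise.mem_convexHull_arc (hv : IsCounterclockwise v N) {i j : ℕ}
    (hij : i + 2 ≤ j) (hj : j ≤ N) {x : Plane}
    (hedge : ∀ m, i ≤ m → m < j → 0 ≤ cross (v m) (v (m + 1)) x)
    (hchord : 0 ≤ cross (v j) (v i) x) : x ∈ convexHull ℝ (arc v i j : Set Plane) := by
  induction j, hij using Nat.le_induction with
  | base =>
    refine convexHull_mono ?_ (mem_convexHull_triangle (hv i (i + 1) (i + 2) (by omega) (by omega)
      hj) (hedge i le_rfl (by omega)) (hedge (i + 1) (by omega) (by omega)) hchord)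
    rw [← coe_triangle]
    exact Finset.coe_subset.mpr (triangle_subset_arc le_rfl (by omega) (by omega) le_rfl)
  | succ j hij ih =>
    -- The chord `v i v j` cuts the last ear `v i, v j, v (j + 1)` off the polygon; `x` is either in
    -- the smaller polygon or in the ear.
    rcases le_total 0 (cross (v j) (v i) x) with h | h
    · exact convexHull_mono (Finset.coe_subset.mpr (arc_subset_arc le_rfl (by omega)))
        (ih (by omega) (fun m h1 h2 => hedge m h1 (by omega)) h)
    · refine convexHull_mono ?_ (mem_convexHull_triangle (hv i j (j + 1) (by omega) (by omega)
        hj) (by rw [cross_swap]; linarith) (hedge j (by omega) (by omega)) hchord)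
      rw [← coe_triangle]
      exact Finset.coe_subset.mpr (triangle_subset_arc le_rfl (by omega) (by omega) le_rfl)

theorem IsCounterclockwise.interior_nonempty (hv : IsCounterclockwise v N) {x y z : ℕ}
    (hxy : x < y) (hyz : y < z) (hz : z ≤ N) :
    (interior (convexHull ℝ (triangle v x y z : Set Plane))).Nonempty :=
  interior_convexHull_triangle_nonempty (hv x y z hxy hyz hz) (coe_triangle x y z).ge

theorem IsCounterclockwise.not_disjoint (hv : IsCounterclockwise v N) {p q r t : ℕ} (hpq : p < q)
    (hqr : q < r) (hrt : r < t) (ht : t ≤ N) {S T : Finset Plane} (hp : v p ∈ S) (hr : v r ∈ S)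
    (hq : v q ∈ T) (ht' : v t ∈ T) (hS : (interior (convexHull ℝ (S : Set Plane))).Nonempty)
    (hT : (interior (convexHull ℝ (T : Set Plane))).Nonempty) :
    ¬Disjoint (interior (convexHull ℝ (S : Set Plane)))
      (interior (convexHull ℝ (T : Set Plane))) :=
  not_disjoint_interior_of_crossing (hv p q r hpq hqr (by omega)) (hv q r t hqr hrt ht)
    (hv p q t hpq (by omega) ht) (hv p r t (by omega) hrt ht) hp hr hq ht' hS hT

/-- Triangles not overlapping `v i, v k, v j` lie on one side of it. -/
theorem IsCounterclockwise.subset_arc_or_subset_arc (hv : IsCounterclockwise v N) {i k j : ℕ}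
    (hik : i < k) (hkj : k < j) (hj : j ≤ N) {s : Finset Plane} (hs : s ⊆ arc v i j)
    (hs3 : #s = 3) (hne : s ≠ triangle v i k j)
    (hd : Disjoint (interior (convexHull ℝ (s : Set Plane)))
      (interior (convexHull ℝ (triangle v i k j : Set Plane)))) :
    s ⊆ arc v i k ∨ s ⊆ arc v k j := by
  obtain ⟨x, y, z, hix, hxy, hyz, hzj, rfl⟩ := exists_triangle_eq hs hs3
  have hn1 := hv.interior_nonempty hxy hyz (by omega)
  have hn2 := hv.interior_nonempty hik hkj (by omega)
  by_cases hzk : z ≤ k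
  · exact Or.inl (triangle_subset_arc hix hxy.le hyz.le hzk)
  by_cases hkx : k ≤ x
  · exact Or.inr (triangle_subset_arc hkx hxy.le hyz.le hzj)
  -- A triangle with vertices strictly on both sides of `v k`, other than the given one, has a side
  -- crossing a side of `v i, v k, v j`. The cases exhibit the four alternating endpoints.
  exfalso
  by_cases h1 : i < x
  · exact hv.not_disjoint (p := i) (q := x) (r := k) (t := z) (by omega) (by omega) (by omega)
      (by omega) (by simp [triangle]) (by simp [triangle]) (by simp [triangle])
      (by simp [triangle]) hn2 hn1 hd.symm
  obtain rfl : i = x := by omega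
  by_cases h2 : z < j
  · exact hv.not_disjoint (p := i) (q := k) (r := z) (t := j) (by omega) (by omega) (by omega)
      (by omega) (by simp [triangle]) (by simp [triangle]) (by simp [triangle])
      (by simp [triangle]) hn1 hn2 hd
  obtain rfl : z = j := by omega
  rcases lt_trichotomy y k with h3 | rfl | h3
  · exact hv.not_disjoint (p := i) (q := y) (r := k) (t := z) (by omega) (by omega) (by omega)
      (by omega) (by simp [triangle]) (by simp [triangle]) (by simp [triangle])
      (by simp [triangle]) hn2 hn1 hd.symm
  · exact hne rfl
  · exact hv.not_disjoint (p := i) (q := k) (r := y) (t := z) (by omega) (by omega) (by omega)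
      (by omega) (by simp [triangle]) (by simp [triangle]) (by simp [triangle])
      (by simp [triangle]) hn1 hn2 hd

/-- The midpoint of `v i v j` is covered by some triangle. A triangle avoiding `v i` lies beyond the
chord `v (i + 1) v j`, and one avoiding `v j` beyond `v i v (j - 1)`, so neither can contain this
midpoint. -/
theorem IsTriangulation.exists_triangle_mem (hv : IsCounterclockwise v N) {i j : ℕ}
    (hij : i + 2 ≤ j) (hj : j ≤ N) {τ : Finset (Finset Plane)}
    (hτ : IsTriangulation (arc v i j) τ) : ∃ k, i < k ∧ k < j ∧ triangle v i k j ∈ τ := by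
  have hN : 2 ≤ N := by omega
  have hcard := hv.card_arc hN (i := i) hj
  have hU := hτ.iUnion_eq (by omega)
  have hM : (1 / 2 : ℝ) • v i + (1 / 2 : ℝ) • v j ∈ convexHull ℝ (arc v i j : Set Plane) :=
    convex_convexHull ℝ _ (subset_convexHull ℝ _ (apply_mem_arc le_rfl (by omega)))
      (subset_convexHull ℝ _ (apply_mem_arc (by omega) le_rfl)) (by norm_num) (by norm_num)
      (by norm_num)
  rw [← hU] at hM
  simp only [Set.mem_iUnion] at hM
  obtain ⟨s, hsτ, hMs⟩ := hM
  obtain ⟨x, y, z, hix, hxy, hyz, hzj, rfl⟩ := exists_triangle_eq (hτ.subset s hsτ)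
    (hτ.card_eq s hsτ)
  have hx : i = x := by
    by_contra hne
    have hsub : triangle v x y z ⊆ arc v (i + 1) j :=
      triangle_subset_arc (by omega) hxy.le hyz.le hzj
    have := hv.cross_chord_nonneg hj (convexHull_mono (Finset.coe_subset.mpr hsub) hMs)
    rw [cross_combo _ _ _ _ (by norm_num), cross_self_outer, cross_swap, cross_rotate] at this
    have h2 := hv i (i + 1) j (by omega) (by omega) hj
    linarith
  have hz : z = j := by
    by_contra hne
    have hsub : triangle v x y z ⊆ arc v i (j - 1) :=
      triangle_subset_arc (by omega) hxy.le hyz.le (by omega)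
    have := hv.cross_chord_nonneg (by omega) (convexHull_mono (Finset.coe_subset.mpr hsub) hMs)
    rw [cross_combo _ _ _ _ (by norm_num), cross_self_right, cross_swap] at this
    have h2 := hv i (j - 1) j (by omega) (by omega) hj
    linarith
  subst hx hz
  exact ⟨y, hxy, hyz, hsτ⟩

theorem isClosed_biUnion_convexHull (τ : Finset (Finset Plane)) :
    IsClosed (⋃ s ∈ τ, convexHull ℝ (s : Set Plane)) :=
  Set.Finite.isClosed_biUnion τ.finite_toSet fun s _ =>
    (s.finite_toSet.isCompact_convexHull (𝕜 := ℝ)).isClosed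

theorem IsCounterclockwise.cross_nonneg_of_mem_right (hv : IsCounterclockwise v N) {i k j : ℕ}
    (hik : i ≤ k) (hkj : k ≤ j) (hj : j ≤ N) {y : Plane}
    (hy : y ∈ arc v k j ∨ y ∈ triangle v i k j) : 0 ≤ cross (v i) (v k) y := by
  rcases hy with hy | hy
  · obtain ⟨l, h1, h2, rfl⟩ := mem_arc.mp hy
    exact hv.cross_nonneg hik h1 (by omega)
  · rcases mem_triangle.mp hy with rfl | rfl | rfl
    · rw [cross_self_outer]
    · rw [cross_self_right]
    · exact hv.cross_nonneg hik hkj hj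

theorem IsCounterclockwise.cross_nonneg_of_mem_left (hv : IsCounterclockwise v N) {i k j : ℕ}
    (hik : i ≤ k) (hkj : k ≤ j) (hj : j ≤ N) {y : Plane}
    (hy : y ∈ arc v i k ∨ y ∈ triangle v i k j) : 0 ≤ cross (v k) (v j) y := by
  rcases hy with hy | hy
  · obtain ⟨l, h1, h2, rfl⟩ := mem_arc.mp hy
    rw [cross_rotate]
    exact hv.cross_nonneg h2 hkj (by omega)
  · rcases mem_triangle.mp hy with rfl | rfl | rfl
    · rw [cross_rotate]
      exact hv.cross_nonneg hik hkj hj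
    · rw [cross_self_outer]
    · rw [cross_self_right]

theorem IsCounterclockwise.cross_nonpos_of_mem_arc (hv : IsCounterclockwise v N) {i j : ℕ}
    (hj : j ≤ N) {y : Plane} (hy : y ∈ arc v i j) : cross (v i) (v j) y ≤ 0 := by
  have := hv.cross_chord_nonneg hj (subset_convexHull ℝ _ hy)
  rw [cross_swap] at this
  linarith

theorem IsTriangulation.subset_arc_or_subset_arc (hv : IsCounterclockwise v N) {i k j : ℕ}
    (hik : i < k) (hkj : k < j) (hj : j ≤ N) {τ : Finset (Finset Plane)}
    (hτ : IsTriangulation (arc v i j) τ) (ht : triangle v i k j ∈ τ) {s : Finset Plane}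
    (hs : s ∈ τ) : s = triangle v i k j ∨ s ⊆ arc v i k ∨ s ⊆ arc v k j := by
  by_cases h : s = triangle v i k j
  · exact Or.inl h
  · exact Or.inr (hv.subset_arc_or_subset_arc hik hkj hj (hτ.subset s hs) (hτ.card_eq s hs) h
      (hτ.nonoverlapping s hs _ ht h))

open Classical in
-- Only the covering needs an argument. A point strictly beyond the chord `v i v k` is not in the
-- root triangle nor in a triangle on the right, so a triangle on the left covers it. The points on
-- the chord follow because a finite union of triangles is closed.
theorem IsTriangulation.left (hv : IsCounterclockwise v N) {i k j : ℕ}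
    (hik : i < k) (hkj : k < j) (hj : j ≤ N) {τ : Finset (Finset Plane)}
    (hτ : IsTriangulation (arc v i j) τ) (ht : triangle v i k j ∈ τ) :
    IsTriangulation (arc v i k) {s ∈ τ | s ⊆ arc v i k} where
  subset s hs := (Finset.mem_filter.mp hs).2
  card_eq s hs := hτ.card_eq s (Finset.mem_filter.mp hs).1
  nonoverlapping s hs t ht := hτ.nonoverlapping s (Finset.mem_filter.mp hs).1 t
    (Finset.mem_filter.mp ht).1
  iUnion_eq h3 := by
    have hN : 2 ≤ N := by omega
    rw [hv.card_arc hN (by omega)] at h3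
    apply Set.Subset.antisymm
    · exact Set.iUnion₂_subset fun s hs => convexHull_mono (Finset.mem_filter.mp hs).2
    have hU := hτ.iUnion_eq (by rw [hv.card_arc hN hj]; omega)
    refine Convex.subset_of_cross_pos_subset (convex_convexHull ℝ _)
      (isClosed_biUnion_convexHull _) (a := v k) (b := v i) (y := v (i + 1))
      (subset_convexHull ℝ _ (apply_mem_arc (by omega) (by omega)))
      (by rw [← cross_rotate]; exact hv _ _ _ (by omega) (by omega) (by omega))
      (fun x hx => hv.cross_chord_nonneg (by omega) hx) fun x hx hpos => ?_
    have hx' : x ∈ convexHull ℝ (arc v i j : Set Plane) :=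
      convexHull_mono (Finset.coe_subset.mpr (arc_subset_arc le_rfl hkj.le)) hx
    rw [← hU] at hx'
    simp only [Set.mem_iUnion] at hx' ⊢
    obtain ⟨s, hsτ, hxs⟩ := hx'
    refine ⟨s, Finset.mem_filter.mpr ⟨hsτ, ?_⟩, hxs⟩
    have hfar : ¬∀ y ∈ s, y ∈ arc v k j ∨ y ∈ triangle v i k j := by
      intro h
      have := cross_nonneg_of_mem_convexHull
        (fun y hy => hv.cross_nonneg_of_mem_right hik.le hkj.le hj (h y hy)) hxs
      rw [cross_swap] at hpos
      linarith
    rcases hτ.subset_arc_or_subset_arc hv hik hkj hj ht hsτ with rfl | h | h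
    · exact absurd (fun y hy => Or.inr hy) hfar
    · exact h
    · exact absurd (fun y hy => Or.inl (h hy)) hfar

open Classical in
theorem IsTriangulation.right (hv : IsCounterclockwise v N) {i k j : ℕ}
    (hik : i < k) (hkj : k < j) (hj : j ≤ N) {τ : Finset (Finset Plane)}
    (hτ : IsTriangulation (arc v i j) τ) (ht : triangle v i k j ∈ τ) :
    IsTriangulation (arc v k j) {s ∈ τ | s ⊆ arc v k j} where
  subset s hs := (Finset.mem_filter.mp hs).2
  card_eq s hs := hτ.card_eq s (Finset.mem_filter.mp hs).1
  nonoverlapping s hs t ht := hτ.nonoverlapping s (Finset.mem_filter.mp hs).1 t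
    (Finset.mem_filter.mp ht).1
  iUnion_eq h3 := by
    have hN : 2 ≤ N := by omega
    rw [hv.card_arc hN (by omega)] at h3
    apply Set.Subset.antisymm
    · exact Set.iUnion₂_subset fun s hs => convexHull_mono (Finset.mem_filter.mp hs).2
    have hU := hτ.iUnion_eq (by rw [hv.card_arc hN hj]; omega)
    refine Convex.subset_of_cross_pos_subset (convex_convexHull ℝ _)
      (isClosed_biUnion_convexHull _) (a := v j) (b := v k) (y := v (k + 1))
      (subset_convexHull ℝ _ (apply_mem_arc (by omega) (by omega)))
      (by rw [← cross_rotate]; exact hv _ _ _ (by omega) (by omega) (by omega))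
      (fun x hx => hv.cross_chord_nonneg hj hx) fun x hx hpos => ?_
    have hx' : x ∈ convexHull ℝ (arc v i j : Set Plane) :=
      convexHull_mono (Finset.coe_subset.mpr (arc_subset_arc hik.le le_rfl)) hx
    rw [← hU] at hx'
    simp only [Set.mem_iUnion] at hx' ⊢
    obtain ⟨s, hsτ, hxs⟩ := hx'
    refine ⟨s, Finset.mem_filter.mpr ⟨hsτ, ?_⟩, hxs⟩
    have hfar : ¬∀ y ∈ s, y ∈ arc v i k ∨ y ∈ triangle v i k j := by
      intro h
      have := cross_nonneg_of_mem_convexHull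
        (fun y hy => hv.cross_nonneg_of_mem_left hik.le hkj.le hj (h y hy)) hxs
      rw [cross_swap] at hpos
      linarith
    rcases hτ.subset_arc_or_subset_arc hv hik hkj hj ht hsτ with rfl | h | h
    · exact absurd (fun y hy => Or.inr hy) hfar
    · exact absurd (fun y hy => Or.inl (h hy)) hfar
    · exact h

/-- The lines `v i v k` and `v k v j` sort the points. The bounds `i + 2 ≤ k` and `k + 2 ≤ j` matter
because triangulations of a double edge cover nothing; when a side of the triangle is an edge of the
polygon, no point lies beyond it. -/
theorem IsCounterclockwise.convexHull_arc_subset (hv : IsCounterclockwise v N) {i k j : ℕ}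
    (hik : i < k) (hkj : k < j) (hj : j ≤ N) {x : Plane}
    (hx : x ∈ convexHull ℝ (arc v i j : Set Plane)) :
    x ∈ convexHull ℝ (triangle v i k j : Set Plane) ∨
      i + 2 ≤ k ∧ x ∈ convexHull ℝ (arc v i k : Set Plane) ∨
      k + 2 ≤ j ∧ x ∈ convexHull ℝ (arc v k j : Set Plane) := by
  by_cases h1 : 0 ≤ cross (v i) (v k) x
  · by_cases h2 : 0 ≤ cross (v k) (v j) x
    · left
      rw [coe_triangle]
      exact mem_convexHull_triangle (hv i k j hik hkj hj) h1 h2 (hv.cross_chord_nonneg hj hx)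
    · right; right
      have hk : k + 2 ≤ j := by
        by_contra hk
        obtain rfl : j = k + 1 := by omega
        exact h2 (hv.cross_edge_nonneg hj (Nat.lt_succ_self k) hx)
      refine ⟨hk, hv.mem_convexHull_arc hk hj (fun m _ hm => hv.cross_edge_nonneg hj hm hx) ?_⟩
      rw [cross_swap]; linarith
  · right; left
    have hk : i + 2 ≤ k := by
      by_contra hk
      obtain rfl : k = i + 1 := by omega
      exact h1 (hv.cross_edge_nonneg hj (by omega) hx)
    refine ⟨hk, hv.mem_convexHull_arc hk (by omega)
      (fun m _ hm => hv.cross_edge_nonneg hj (by omega) hx) ?_⟩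
    rw [cross_swap]; linarith

open Classical in
-- The line `v i v k` separates `L` from the root triangle and from `R`; the line `v k v j`
-- separates `R` from the root triangle.
theorem IsTriangulation.glue (hv : IsCounterclockwise v N) {i k j : ℕ}
    (hik : i < k) (hkj : k < j) (hj : j ≤ N) {L R : Finset (Finset Plane)}
    (hL : IsTriangulation (arc v i k) L) (hR : IsTriangulation (arc v k j) R) :
    IsTriangulation (arc v i j) (insert (triangle v i k j) (L ∪ R)) := by
  have hN : 2 ≤ N := by omega
  have hsubset : ∀ s ∈ insert (triangle v i k j) (L ∪ R), s ⊆ arc v i j := by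
    intro s hs
    rcases Finset.mem_insert.mp hs with rfl | hs
    · exact triangle_subset_arc le_rfl hik.le hkj.le le_rfl
    rcases Finset.mem_union.mp hs with hs | hs
    · exact (hL.subset s hs).trans (arc_subset_arc le_rfl hkj.le)
    · exact (hR.subset s hs).trans (arc_subset_arc hik.le le_rfl)
  have hc1 : cross (v i) (v k) (v j) ≠ 0 := (hv i k j hik hkj hj).ne'
  have hc2 : cross (v k) (v j) (v i) ≠ 0 := by rwa [cross_rotate]
  have hLR : ∀ s ∈ L, ∀ t ∈ R, Disjoint (interior (convexHull ℝ (s : Set Plane)))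
      (interior (convexHull ℝ (t : Set Plane))) := fun s hs t ht =>
    (disjoint_interior_of_cross hc1
      (fun y hy => hv.cross_nonneg_of_mem_right hik.le hkj.le hj (Or.inl (hR.subset t ht hy)))
      (fun y hy => hv.cross_nonpos_of_mem_arc (by omega) (hL.subset s hs hy))).symm
  have hLt : ∀ s ∈ L, Disjoint (interior (convexHull ℝ (s : Set Plane)))
      (interior (convexHull ℝ (triangle v i k j : Set Plane))) := fun s hs =>
    (disjoint_interior_of_cross hc1
      (fun y hy => hv.cross_nonneg_of_mem_right hik.le hkj.le hj (Or.inr hy))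
      (fun y hy => hv.cross_nonpos_of_mem_arc (by omega) (hL.subset s hs hy))).symm
  have hRt : ∀ s ∈ R, Disjoint (interior (convexHull ℝ (s : Set Plane)))
      (interior (convexHull ℝ (triangle v i k j : Set Plane))) := fun s hs =>
    (disjoint_interior_of_cross hc2
      (fun y hy => hv.cross_nonneg_of_mem_left hik.le hkj.le hj (Or.inr hy))
      (fun y hy => hv.cross_nonpos_of_mem_arc hj (hR.subset s hs hy))).symm
  refine ⟨hsubset, ?_, ?_, fun _ => ?_⟩
  · intro s hs
    rcases Finset.mem_insert.mp hs with rfl | hs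
    · exact hv.card_triangle hik hkj hj
    rcases Finset.mem_union.mp hs with hs | hs
    · exact hL.card_eq s hs
    · exact hR.card_eq s hs
  · intro s hs t ht hne
    simp only [Finset.mem_insert, Finset.mem_union] at hs ht
    rcases hs with rfl | hs | hs <;> rcases ht with rfl | ht | ht
    · exact absurd rfl hne
    · exact (hLt t ht).symm
    · exact (hRt t ht).symm
    · exact hLt s hs
    · exact hL.nonoverlapping s hs t ht hne
    · exact hLR s hs t ht
    · exact hRt s hs
    · exact (hLR t ht s hs).symm
    · exact hR.nonoverlapping s hs t ht hne
  · apply Set.Subset.antisymm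
    · exact Set.iUnion₂_subset fun s hs => convexHull_mono (hsubset s hs)
    · intro x hx
      rcases hv.convexHull_arc_subset hik hkj hj hx with h | ⟨hk, h⟩ | ⟨hk, h⟩
      · exact Set.mem_biUnion (Finset.mem_insert_self _ _) h
      · rw [← hL.iUnion_eq (by rw [hv.card_arc hN (by omega)]; omega)] at h
        exact Set.biUnion_mono (fun s hs => Finset.mem_insert_of_mem (Finset.mem_union_left _ hs))
          (fun _ _ => subset_rfl) h
      · rw [← hR.iUnion_eq (by rw [hv.card_arc hN hj]; omega)] at h
        exact Set.biUnion_mono (fun s hs => Finset.mem_insert_of_mem (Finset.mem_union_right _ hs))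
          (fun _ _ => subset_rfl) h

open Classical in
/-- A triangulation of a polygon consists of a triangle containing a given edge, and of
triangulations of the polygons on both sides of this triangle. -/
theorem isTriangulation_arc_iff (hv : IsCounterclockwise v N) {i j : ℕ}
    (hij : i + 2 ≤ j) (hj : j ≤ N) {τ : Finset (Finset Plane)} :
    IsTriangulation (arc v i j) τ ↔ ∃ k, i < k ∧ k < j ∧ ∃ L R,
      IsTriangulation (arc v i k) L ∧ IsTriangulation (arc v k j) R ∧
        τ = insert (triangle v i k j) (L ∪ R) := by
  constructor
  · intro hτ
    obtain ⟨k, hik, hkj, ht⟩ := hτ.exists_triangle_mem hv hij hj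
    refine ⟨k, hik, hkj, _, _, hτ.left hv hik hkj hj ht, hτ.right hv hik hkj hj ht, ?_⟩
    ext s
    simp only [Finset.mem_insert, Finset.mem_union, Finset.mem_filter]
    constructor
    · intro hs
      rcases hτ.subset_arc_or_subset_arc hv hik hkj hj ht hs with h | h | h
      · exact Or.inl h
      · exact Or.inr (Or.inl ⟨hs, h⟩)
      · exact Or.inr (Or.inr ⟨hs, h⟩)
    · rintro (rfl | ⟨hs, _⟩ | ⟨hs, _⟩)
      · exact ht
      · exact hs
      · exact hs
  · rintro ⟨k, hik, hkj, L, R, hL, hR, rfl⟩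
    exact hL.glue hv hik hkj hj hR

theorem isTriangulation_iff_of_card_le_two {V : Finset Plane} (hV : #V ≤ 2)
    {τ : Finset (Finset Plane)} : IsTriangulation V τ ↔ τ = ∅ := by
  constructor
  · intro h
    refine Finset.eq_empty_of_forall_notMem fun s hs => ?_
    have h1 := Finset.card_le_card (h.subset s hs)
    have h2 := h.card_eq s hs
    omega
  · rintro rfl
    exact ⟨by simp, by simp, by simp, fun h => by omega⟩

end Arc

-- Triangulations as binary trees

section Dissection

open Classical in
mutual
/-- The triangles at even depth in the triangulation of `v i, v (i + 1), …` given by a binary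
tree. -/
noncomputable def evenTriangles (v : ℕ → Plane) : BinaryTree Unit → ℕ → Finset (Finset Plane)
  | .nil, _ => ∅
  | .node _ l r, i =>
      insert (triangle v i (i + l.numNodes + 1) (i + l.numNodes + 1 + r.numNodes + 1))
        (oddTriangles v l i ∪ oddTriangles v r (i + l.numNodes + 1))
/-- The triangles at odd depth in the triangulation of `v i, v (i + 1), …` given by a binary
tree. -/
noncomputable def oddTriangles (v : ℕ → Plane) : BinaryTree Unit → ℕ → Finset (Finset Plane)
  | .nil, _ => ∅
  | .node _ l r, i => evenTriangles v l i ∪ evenTriangles v r (i + l.numNodes + 1)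
end

open Classical in
/-- The triangulation of `v i, v (i + 1), …` given by a binary tree: the root is the triangle
containing the edge joining the first and the last vertex. -/
noncomputable def dissection (v : ℕ → Plane) (t : BinaryTree Unit) (i : ℕ) :
    Finset (Finset Plane) := evenTriangles v t i ∪ oddTriangles v t i

variable {v : ℕ → Plane} {N : ℕ}

theorem dissection_nil (i : ℕ) : dissection v .nil i = ∅ := by
  simp [dissection, evenTriangles, oddTriangles]

open Classical in
theorem dissection_node (u : Unit) (l r : BinaryTree Unit) (i : ℕ) :
    dissection v (.node u l r) i =
      insert (triangle v i (i + l.numNodes + 1) (i + l.numNodes + 1 + r.numNodes + 1))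
        (dissection v l i ∪ dissection v r (i + l.numNodes + 1)) := by
  ext s
  simp only [dissection, evenTriangles, oddTriangles, Finset.mem_union, Finset.mem_insert]
  tauto

theorem numNodes_eq_zero {t : BinaryTree Unit} (h : t.numNodes = 0) : t = .nil := by
  cases t with
  | nil => rfl
  | node => simp at h

/-- Strong induction on the number `m` of triangles, which is two less than the number of vertices;
this explains the index `i + m + 1` of the last vertex. The double edge `m = 0` corresponds to the
empty tree. -/
theorem isTriangulation_arc_iff_exists_tree (hv : IsCounterclockwise v N) (m : ℕ) :
    ∀ i, i + m + 1 ≤ N → ∀ τ, IsTriangulation (arc v i (i + m + 1)) τ ↔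
      ∃ t : BinaryTree Unit, t.numNodes = m ∧ dissection v t i = τ := by
  induction m using Nat.strong_induction_on with
  | _ m ih =>
    intro i hi τ
    rcases Nat.eq_zero_or_pos m with rfl | hm
    · rw [isTriangulation_iff_of_card_le_two]
      · constructor
        · rintro rfl
          exact ⟨.nil, rfl, dissection_nil i⟩
        · rintro ⟨t, ht, rfl⟩
          rw [numNodes_eq_zero ht, dissection_nil]
      · classical
        refine Finset.card_image_le.trans ?_
        simp
        omega
    · rw [isTriangulation_arc_iff hv (by omega) hi]
      constructor
      · rintro ⟨k, hik, hkj, L, R, hL, hR, rfl⟩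
        obtain ⟨a, rfl⟩ : ∃ a, k = i + a + 1 := ⟨k - i - 1, by omega⟩
        obtain ⟨b, hb⟩ : ∃ b, i + m + 1 = i + a + 1 + b + 1 := ⟨m - a - 1, by omega⟩
        rw [hb] at hR
        obtain ⟨l, rfl, rfl⟩ := (ih a (by omega) i (by omega) L).mp hL
        obtain ⟨r, rfl, rfl⟩ := (ih b (by omega) _ (by omega) R).mp hR
        refine ⟨.node () l r, by simp only [BinaryTree.numNodes]; omega, ?_⟩
        rw [dissection_node, hb]
      · rintro ⟨t, ht, rfl⟩
        cases t with
        | nil => simp at ht; omega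
        | node u l r =>
          simp only [BinaryTree.numNodes] at ht
          have hj : i + m + 1 = i + l.numNodes + 1 + r.numNodes + 1 := by omega
          refine ⟨i + l.numNodes + 1, by omega, by omega, dissection v l i,
            dissection v r (i + l.numNodes + 1),
            (ih _ (by omega) i (by omega) _).mpr ⟨l, rfl, rfl⟩, ?_, ?_⟩
          · rw [hj]
            exact (ih _ (by omega) _ (by omega) _).mpr ⟨r, rfl, rfl⟩
          · rw [dissection_node, hj]

theorem isTriangulation_dissection (hv : IsCounterclockwise v N) (t : BinaryTree Unit) {i : ℕ}
    (hi : i + t.numNodes + 1 ≤ N) :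
    IsTriangulation (arc v i (i + t.numNodes + 1)) (dissection v t i) :=
  (isTriangulation_arc_iff_exists_tree hv _ i hi _).mpr ⟨t, rfl, rfl⟩

theorem subset_arc_of_mem_dissection (hv : IsCounterclockwise v N) {t : BinaryTree Unit} {i j : ℕ}
    (hj : i + t.numNodes + 1 = j) (hjN : j ≤ N) {s : Finset Plane} (hs : s ∈ dissection v t i) :
    s ⊆ arc v i j := by
  subst hj
  exact (isTriangulation_dissection hv t hjN).subset s hs

theorem card_eq_three_of_mem_dissection (hv : IsCounterclockwise v N) {t : BinaryTree Unit} {i : ℕ}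
    (hi : i + t.numNodes + 1 ≤ N) {s : Finset Plane} (hs : s ∈ dissection v t i) : #s = 3 :=
  (isTriangulation_dissection hv t hi).card_eq s hs

section Node

variable {l r : BinaryTree Unit} {i k j : ℕ}

theorem mem_dissection_node (u : Unit) (hk : i + l.numNodes + 1 = k) (hj : k + r.numNodes + 1 = j)
    {s : Finset Plane} : s ∈ dissection v (.node u l r) i ↔
      s = triangle v i k j ∨ s ∈ dissection v l i ∨ s ∈ dissection v r k := by
  subst hk hj
  rw [dissection_node, Finset.mem_insert, Finset.mem_union]

theorem mem_evenTriangles_node (u : Unit) (hk : i + l.numNodes + 1 = k)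
    (hj : k + r.numNodes + 1 = j) {s : Finset Plane} : s ∈ evenTriangles v (.node u l r) i ↔
      s = triangle v i k j ∨ s ∈ oddTriangles v l i ∨ s ∈ oddTriangles v r k := by
  subst hk hj
  rw [evenTriangles, Finset.mem_insert, Finset.mem_union]

theorem mem_oddTriangles_node (u : Unit) (hk : i + l.numNodes + 1 = k) {s : Finset Plane} :
    s ∈ oddTriangles v (.node u l r) i ↔ s ∈ evenTriangles v l i ∨ s ∈ evenTriangles v r k := by
  subst hk
  rw [oddTriangles, Finset.mem_union]

theorem last_notMem_of_mem_left (hv : IsCounterclockwise v N) (hk : i + l.numNodes + 1 = k)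
    (hkj : k < j) (hjN : j ≤ N) {s : Finset Plane} (hs : s ∈ dissection v l i) : v j ∉ s := by
  intro h
  have := subset_arc_of_mem_dissection hv hk (by omega) hs h
  rw [hv.apply_mem_arc_iff (by omega) hjN (by omega)] at this
  omega

theorem first_notMem_of_mem_right (hv : IsCounterclockwise v N) (hik : i < k)
    (hj : k + r.numNodes + 1 = j) (hjN : j ≤ N) {s : Finset Plane} (hs : s ∈ dissection v r k) :
    v i ∉ s := by
  intro h
  have := subset_arc_of_mem_dissection hv hj (by omega) hs h
  rw [hv.apply_mem_arc_iff (by omega) (by omega) (by omega)] at this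
  omega

open Classical in
theorem card_inter_le_one_of_subset_arc (hv : IsCounterclockwise v N) (hN : 2 ≤ N) (hk : k ≤ N)
    (hjN : j ≤ N) {s s' : Finset Plane} (hs : s ⊆ arc v i k) (hs' : s' ⊆ arc v k j) :
    #(s ∩ s') ≤ 1 := by
  have : s ∩ s' ⊆ {v k} := by
    intro p hp
    rw [Finset.mem_inter] at hp
    obtain ⟨a, h1, h2, rfl⟩ := mem_arc.mp (hs hp.1)
    have h3 := hs' hp.2
    rw [hv.apply_mem_arc_iff hN (by omega) hjN] at h3
    obtain rfl : a = k := by omega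
    simp
  exact Finset.card_le_card this

theorem eq_triangle_of_mem_of_mem (hv : IsCounterclockwise v N) (u : Unit)
    (hk : i + l.numNodes + 1 = k) (hj : k + r.numNodes + 1 = j) (hjN : j ≤ N) {s : Finset Plane}
    (hs : s ∈ dissection v (.node u l r) i) (his : v i ∈ s) (hjs : v j ∈ s) :
    s = triangle v i k j := by
  rcases (mem_dissection_node u hk hj).mp hs with h | h | h
  · exact h
  · exact absurd hjs (last_notMem_of_mem_left hv hk (by omega) hjN h)
  · exact absurd his (first_notMem_of_mem_right hv (by omega) hj hjN h)

theorem triangle_notMem_left (hv : IsCounterclockwise v N) (hk : i + l.numNodes + 1 = k)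
    (hkj : k < j) (hjN : j ≤ N) : triangle v i k j ∉ dissection v l i := fun h =>
  last_notMem_of_mem_left hv hk hkj hjN h (by simp [triangle])

theorem triangle_notMem_right (hv : IsCounterclockwise v N) (hik : i < k)
    (hj : k + r.numNodes + 1 = j) (hjN : j ≤ N) : triangle v i k j ∉ dissection v r k := fun h =>
  first_notMem_of_mem_right hv hik hj hjN h (by simp [triangle])

open Classical in
-- The two arcs share only `v k`, too little for a common triangle.
theorem notMem_right_of_mem_left (hv : IsCounterclockwise v N) (hk : i + l.numNodes + 1 = k)
    (hj : k + r.numNodes + 1 = j) (hjN : j ≤ N) {s : Finset Plane} (hs : s ⊆ arc v i k) :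
    s ∉ dissection v r k := by
  intro h
  have h1 := card_inter_le_one_of_subset_arc hv (by omega) (by omega) hjN hs
    (subset_arc_of_mem_dissection hv hj hjN h)
  rw [Finset.inter_self, card_eq_three_of_mem_dissection hv (by omega) h] at h1
  omega

open Classical in
theorem notMem_left_of_mem_right (hv : IsCounterclockwise v N) (hk : i + l.numNodes + 1 = k)
    (hj : k + r.numNodes + 1 = j) (hjN : j ≤ N) {s : Finset Plane} (hs : s ⊆ arc v k j) :
    s ∉ dissection v l i := by
  intro h
  have h1 := card_inter_le_one_of_subset_arc hv (by omega) (by omega) hjN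
    (subset_arc_of_mem_dissection hv hk (by omega) h) hs
  rw [Finset.inter_self, card_eq_three_of_mem_dissection hv (by omega) h] at h1
  omega

/-- Recovers the left dissection from the whole one and the apex, as needed for injectivity. -/
theorem mem_left_iff (hv : IsCounterclockwise v N) (u : Unit)
    (hk : i + l.numNodes + 1 = k) (hj : k + r.numNodes + 1 = j) (hjN : j ≤ N) {s : Finset Plane} :
    s ∈ dissection v l i ↔ s ∈ dissection v (.node u l r) i ∧ s ⊆ arc v i k := by
  rw [mem_dissection_node u hk hj]
  constructor
  · intro h
    exact ⟨Or.inr (Or.inl h), subset_arc_of_mem_dissection hv hk (by omega) h⟩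
  · rintro ⟨rfl | h | h, h'⟩
    · have := h' (by simp [triangle] : v j ∈ _)
      rw [hv.apply_mem_arc_iff (by omega) hjN (by omega)] at this
      omega
    · exact h
    · exact absurd h (notMem_right_of_mem_left hv hk hj hjN h')

theorem mem_right_iff (hv : IsCounterclockwise v N) (u : Unit)
    (hk : i + l.numNodes + 1 = k) (hj : k + r.numNodes + 1 = j) (hjN : j ≤ N) {s : Finset Plane} :
    s ∈ dissection v r k ↔ s ∈ dissection v (.node u l r) i ∧ s ⊆ arc v k j := by
  rw [mem_dissection_node u hk hj]
  constructor
  · intro h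
    exact ⟨Or.inr (Or.inr h), subset_arc_of_mem_dissection hv hj hjN h⟩
  · rintro ⟨rfl | h | h, h'⟩
    · have := h' (by simp [triangle] : v i ∈ _)
      rw [hv.apply_mem_arc_iff (by omega) (by omega) (by omega)] at this
      omega
    · exact absurd h (notMem_left_of_mem_right hv hk hj hjN h')
    · exact h

end Node

/-- The root triangle is the only one containing both end vertices. Its apex gives the sizes of the
subtrees, and restriction to the two arcs gives their dissections. -/
theorem dissection_injective (hv : IsCounterclockwise v N) (t : BinaryTree Unit) :
    ∀ t' i, i + t.numNodes + 1 ≤ N → t.numNodes = t'.numNodes →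
      dissection v t i = dissection v t' i → t = t' := by
  induction t with
  | nil => intro t' i _ h _; exact (numNodes_eq_zero h.symm).symm
  | node u l r ihl ihr =>
    intro t' i hi hn h
    cases t' with
    | nil => simp at hn
    | node u' l' r' =>
      simp only [BinaryTree.numNodes] at hi hn
      have hT : triangle v i (i + l.numNodes + 1) (i + l.numNodes + 1 + r.numNodes + 1) ∈
          dissection v (.node u' l' r') i := by
        rw [← h, mem_dissection_node u rfl rfl]; exact Or.inl rfl
      have hj : i + l.numNodes + 1 + r.numNodes + 1 =
        i + l'.numNodes + 1 + r'.numNodes + 1 := by omega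
      have hT' := eq_triangle_of_mem_of_mem hv u' rfl rfl (by omega) hT (by simp [triangle])
        (by rw [← hj]; simp [triangle])
      have hk : l.numNodes = l'.numNodes := by
        have hm : v (i + l.numNodes + 1) ∈ triangle v i (i + l'.numNodes + 1)
          (i + l'.numNodes + 1 + r'.numNodes + 1) := by rw [← hT']; simp [triangle]
        have hN : 2 ≤ N := by omega
        rcases mem_triangle.mp hm with h1 | h1 | h1 <;>
          have := hv.eq_of_apply_eq hN (by omega) (by omega) h1 <;> omega
      have hr : r.numNodes = r'.numNodes := by omega
      have hl' : dissection v l i = dissection v l' i := by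
        ext s
        rw [mem_left_iff (l := l) (r := r) hv u rfl rfl (by omega),
          mem_left_iff (l := l') (r := r') hv u' rfl rfl (by omega), h, hk]
      have hr' : dissection v r (i + l.numNodes + 1) = dissection v r' (i + l.numNodes + 1) := by
        ext s
        rw [mem_right_iff (l := l) (r := r) hv u rfl rfl (by omega), hk,
          mem_right_iff (l := l') (r := r') hv u' rfl rfl (by omega), h, hr]
      rw [ihl l' i (by omega) hk hl', ihr r' _ (by omega) hr hr']

-- Checkerboard colourings and parity of depth

section Colouring

theorem evenTriangles_subset (t : BinaryTree Unit) (i : ℕ) :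
    evenTriangles v t i ⊆ dissection v t i := by
  classical
  exact Finset.subset_union_left

theorem oddTriangles_subset (t : BinaryTree Unit) (i : ℕ) :
    oddTriangles v t i ⊆ dissection v t i := by
  classical
  exact Finset.subset_union_right

theorem disjoint_evenTriangles_oddTriangles (hv : IsCounterclockwise v N) (t : BinaryTree Unit) :
    ∀ i, i + t.numNodes + 1 ≤ N → Disjoint (evenTriangles v t i) (oddTriangles v t i) := by
  induction t with
  | nil => intro i _; simp [evenTriangles]
  | node u l r ihl ihr =>
    intro i hi
    simp only [BinaryTree.numNodes] at hi
    rw [Finset.disjoint_left]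
    intro s hs hs'
    rw [mem_evenTriangles_node u rfl rfl] at hs
    rw [mem_oddTriangles_node u rfl] at hs'
    have hL : ∀ s, s ∈ dissection v l i → s ∉ dissection v r (i + l.numNodes + 1) := fun s h =>
      notMem_right_of_mem_left hv rfl rfl (by omega)
        (subset_arc_of_mem_dissection hv rfl (by omega) h)
    rcases hs with rfl | hs | hs <;> rcases hs' with hs' | hs'
    · exact triangle_notMem_left hv rfl (by omega) (by omega) (evenTriangles_subset _ _ hs')
    · exact triangle_notMem_right hv (by omega) rfl (by omega) (evenTriangles_subset _ _ hs')
    · exact Finset.disjoint_left.mp (ihl i (by omega)) hs' hs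
    · exact hL s (oddTriangles_subset _ _ hs) (evenTriangles_subset _ _ hs')
    · exact hL s (evenTriangles_subset _ _ hs') (oddTriangles_subset _ _ hs)
    · exact Finset.disjoint_left.mp (ihr _ (by omega)) hs' hs

theorem card_triangles (hv : IsCounterclockwise v N) (t : BinaryTree Unit) :
    ∀ i, i + t.numNodes + 1 ≤ N →
      #(evenTriangles v t i) = evenNodes t ∧ #(oddTriangles v t i) = oddNodes t := by
  classical
  induction t with
  | nil => intro i _; simp [evenTriangles, oddTriangles, evenNodes, oddNodes]
  | node u l r ihl ihr =>
    intro i hi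
    simp only [BinaryTree.numNodes] at hi
    have hL : Disjoint (dissection v l i) (dissection v r (i + l.numNodes + 1)) :=
      Finset.disjoint_left.mpr fun s h => notMem_right_of_mem_left hv rfl rfl (by omega)
        (subset_arc_of_mem_dissection hv rfl (by omega) h)
    have h1 := ihl i (by omega)
    have h2 := ihr (i + l.numNodes + 1) (by omega)
    rw [evenTriangles, oddTriangles, evenNodes, oddNodes, Finset.card_insert_of_notMem,
      Finset.card_union_of_disjoint, Finset.card_union_of_disjoint]
    · omega
    · exact hL.mono (evenTriangles_subset _ _) (evenTriangles_subset _ _)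
    · exact hL.mono (oddTriangles_subset _ _) (oddTriangles_subset _ _)
    · rw [Finset.mem_union]
      rintro (h | h)
      · exact triangle_notMem_left hv rfl (by omega) (by omega) (oddTriangles_subset _ _ h)
      · exact triangle_notMem_right hv (by omega) rfl (by omega) (oddTriangles_subset _ _ h)

theorem EdgeAdjacent.symm {s t : Finset Plane} (h : EdgeAdjacent s t) : EdgeAdjacent t s :=
  ⟨h.1.symm, by rw [Finset.inter_comm]; exact h.2⟩

theorem edgeAdjacent_iff_of_eq_insert {T s : Finset Plane} {p q w : Plane}
    (hT : ∀ x, x ∈ T ↔ x = p ∨ x = q ∨ x = w) (hpq : p ≠ q) (hw : w ∉ s) :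
    EdgeAdjacent T s ↔ p ∈ s ∧ q ∈ s := by
  classical
  have hsub : T ∩ s ⊆ {p, q} := by
    intro x hx
    rw [Finset.mem_inter, hT] at hx
    rcases hx with ⟨rfl | rfl | rfl, hx⟩
    · simp
    · simp
    · exact absurd hx hw
  have hpq2 : #({p, q} : Finset Plane) = 2 := Finset.card_pair hpq
  unfold EdgeAdjacent
  constructor
  · rintro ⟨_, h⟩
    have heq : T ∩ s = {p, q} := Finset.eq_of_subset_of_card_le hsub (by rw [hpq2]; convert h.ge)
    have hp : p ∈ T ∩ s := by rw [heq]; simp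
    have hq : q ∈ T ∩ s := by rw [heq]; simp
    exact ⟨(Finset.mem_inter.mp hp).2, (Finset.mem_inter.mp hq).2⟩
  · rintro ⟨hp, hq⟩
    refine ⟨fun h => hw (h ▸ (hT w).mpr (by simp)), ?_⟩
    have heq : T ∩ s = {p, q} := by
      refine Finset.Subset.antisymm hsub fun x hx => ?_
      rw [Finset.mem_inter, hT]
      simp only [Finset.mem_insert, Finset.mem_singleton] at hx
      rcases hx with rfl | rfl <;> simp [*]
    convert (congrArg Finset.card heq).trans hpq2

section Node

variable {l r : BinaryTree Unit} {i k j : ℕ}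

theorem edgeAdjacent_left_iff (hv : IsCounterclockwise v N) (hk : i + l.numNodes + 1 = k)
    (hkj : k < j) (hjN : j ≤ N) {s : Finset Plane} (hs : s ∈ dissection v l i) :
    EdgeAdjacent (triangle v i k j) s ↔ v i ∈ s ∧ v k ∈ s :=
  edgeAdjacent_iff_of_eq_insert (fun _ => mem_triangle) (hv.ne_of_lt (by omega) (by omega)
    (by omega)) (last_notMem_of_mem_left hv hk hkj hjN hs)

theorem edgeAdjacent_right_iff (hv : IsCounterclockwise v N) (hik : i < k)
    (hj : k + r.numNodes + 1 = j) (hjN : j ≤ N) {s : Finset Plane} (hs : s ∈ dissection v r k) :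
    EdgeAdjacent (triangle v i k j) s ↔ v k ∈ s ∧ v j ∈ s :=
  edgeAdjacent_iff_of_eq_insert (fun _ => by rw [mem_triangle]; tauto) (hv.ne_of_lt (by omega)
    (by omega) (by omega)) (first_notMem_of_mem_right hv hik hj hjN hs)

theorem not_edgeAdjacent_left_right (hv : IsCounterclockwise v N) (hk : i + l.numNodes + 1 = k)
    (hj : k + r.numNodes + 1 = j) (hjN : j ≤ N) {s s' : Finset Plane} (hs : s ∈ dissection v l i)
    (hs' : s' ∈ dissection v r k) : ¬EdgeAdjacent s s' := by
  rintro ⟨_, h⟩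
  have h1 := card_inter_le_one_of_subset_arc hv (by omega) (by omega) hjN
    (subset_arc_of_mem_dissection hv hk (by omega) hs) (subset_arc_of_mem_dissection hv hj hjN hs')
  omega

end Node

theorem mem_evenTriangles_of_mem_of_mem (hv : IsCounterclockwise v N) {t : BinaryTree Unit}
    {i j : ℕ} (hj : i + t.numNodes + 1 = j) (hjN : j ≤ N) {s : Finset Plane}
    (hs : s ∈ dissection v t i) (his : v i ∈ s) (hjs : v j ∈ s) : s ∈ evenTriangles v t i := by
  cases t with
  | nil => simp [dissection_nil] at hs
  | node u l r =>
    simp only [BinaryTree.numNodes] at hj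
    rw [mem_evenTriangles_node (k := i + l.numNodes + 1) (j := j) u rfl (by omega)]
    exact Or.inl (eq_triangle_of_mem_of_mem hv u rfl (by omega) hjN hs his hjs)

theorem mem_oddTriangles_iff (hv : IsCounterclockwise v N) {t : BinaryTree Unit} {i : ℕ}
    (hi : i + t.numNodes + 1 ≤ N) {s : Finset Plane} (hs : s ∈ dissection v t i) :
    s ∈ oddTriangles v t i ↔ s ∉ evenTriangles v t i := by
  have hd := disjoint_evenTriangles_oddTriangles hv t i hi
  constructor
  · exact fun h h' => Finset.disjoint_left.mp hd h' h
  · exact (Finset.mem_union.mp hs).resolve_left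

/-- Left and right triangles are never adjacent, and the root triangle is adjacent only to triangles
containing a whole side of it, that is, to the roots of the subtrees. Passing to a subtree flips the
parity, which preserves the colouring condition. -/
theorem isColouring_evenTriangles (hv : IsCounterclockwise v N) (t : BinaryTree Unit) :
    ∀ i, i + t.numNodes + 1 ≤ N → IsColouring (dissection v t i) (evenTriangles v t i) := by
  induction t with
  | nil => intro i _; simp [IsColouring, dissection_nil, evenTriangles]
  | node u l r ihl ihr =>
    intro i hi
    refine ⟨evenTriangles_subset _ _, ?_⟩
    simp only [BinaryTree.numNodes] at hi
    obtain ⟨k, hk⟩ : ∃ k, i + l.numNodes + 1 = k := ⟨_, rfl⟩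
    obtain ⟨j, hj⟩ : ∃ j, k + r.numNodes + 1 = j := ⟨_, rfl⟩
    have hjN : j ≤ N := by omega
    have hLR : ∀ s, s ∈ dissection v l i → s ∉ dissection v r k := fun s h =>
      notMem_right_of_mem_left hv hk hj hjN (subset_arc_of_mem_dissection hv hk (by omega) h)
    have hTl := triangle_notMem_left (l := l) hv hk (show k < j by omega) hjN
    have hTr := triangle_notMem_right (r := r) hv (show i < k by omega) hj hjN
    have evenL : ∀ s ∈ dissection v l i,
        (s ∈ evenTriangles v (.node u l r) i ↔ s ∉ evenTriangles v l i) := by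
      intro s hs
      rw [mem_evenTriangles_node u hk hj, ← mem_oddTriangles_iff hv (by omega) hs]
      constructor
      · rintro (rfl | h | h)
        · exact absurd hs hTl
        · exact h
        · exact absurd (oddTriangles_subset _ _ h) (hLR s hs)
      · exact fun h => Or.inr (Or.inl h)
    have evenR : ∀ s ∈ dissection v r k,
        (s ∈ evenTriangles v (.node u l r) i ↔ s ∉ evenTriangles v r k) := by
      intro s hs
      rw [mem_evenTriangles_node u hk hj, ← mem_oddTriangles_iff hv (by omega) hs]
      constructor
      · rintro (rfl | h | h)
        · exact absurd hs hTr
        · exact absurd hs (hLR s (oddTriangles_subset _ _ h))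
        · exact h
      · exact fun h => Or.inr (Or.inr h)
    have hT : triangle v i k j ∈ evenTriangles v (.node u l r) i := by
      rw [mem_evenTriangles_node u hk hj]; exact Or.inl rfl
    have adjL : ∀ s ∈ dissection v l i, EdgeAdjacent (triangle v i k j) s →
        s ∉ evenTriangles v (.node u l r) i := by
      intro s hs h
      rw [edgeAdjacent_left_iff hv hk (by omega) hjN hs] at h
      rw [evenL s hs, not_not]
      exact mem_evenTriangles_of_mem_of_mem hv hk (by omega) hs h.1 h.2
    have adjR : ∀ s ∈ dissection v r k, EdgeAdjacent (triangle v i k j) s →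
        s ∉ evenTriangles v (.node u l r) i := by
      intro s hs h
      rw [edgeAdjacent_right_iff hv (by omega) hj hjN hs] at h
      rw [evenR s hs, not_not]
      exact mem_evenTriangles_of_mem_of_mem hv hj hjN hs h.1 h.2
    intro s hs s' hs' hadj
    rw [mem_dissection_node u hk hj] at hs hs'
    rcases hs with rfl | hs | hs <;> rcases hs' with rfl | hs' | hs'
    · exact absurd rfl hadj.1
    · exact iff_of_true hT (adjL s' hs' hadj)
    · exact iff_of_true hT (adjR s' hs' hadj)
    · exact iff_of_false (adjL s hs hadj.symm) (not_not.mpr hT)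
    · rw [evenL s hs, evenL s' hs', (ihl i (by omega)).2 s hs s' hs' hadj]
    · exact absurd hadj (not_edgeAdjacent_left_right hv hk hj hjN hs hs')
    · exact iff_of_false (adjR s hs hadj.symm) (not_not.mpr hT)
    · exact absurd hadj.symm (not_edgeAdjacent_left_right hv hk hj hjN hs' hs)
    · rw [evenR s hs, evenR s' hs', (ihr k (by omega)).2 s hs s' hs' hadj]

open Classical in
theorem IsColouring.inter {τ τ' B : Finset (Finset Plane)} (h : IsColouring τ B) (hτ : τ' ⊆ τ) :
    IsColouring τ' (B ∩ τ') := by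
  refine ⟨Finset.inter_subset_right, fun s hs t ht hadj => ?_⟩
  have := h.2 s (hτ hs) t (hτ ht) hadj
  simp only [Finset.mem_inter, hs, ht, and_true]
  exact this

/-- A black root forces white roots in the subtrees and conversely, so the two alternatives must be
carried through the induction together. For the empty tree both hold. -/
theorem IsColouring.eq_of_root (hv : IsCounterclockwise v N) (t : BinaryTree Unit) :
    ∀ i j B, i + t.numNodes + 1 = j → j ≤ N → IsColouring (dissection v t i) B →
      ((∀ s ∈ dissection v t i, v i ∈ s → v j ∈ s → s ∈ B) → B = evenTriangles v t i) ∧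
      ((∀ s ∈ dissection v t i, v i ∈ s → v j ∈ s → s ∉ B) → B = oddTriangles v t i) := by
  classical
  induction t with
  | nil =>
    intro i j B _ _ hB
    have := hB.1
    rw [dissection_nil, Finset.subset_empty] at this
    simp [this, evenTriangles, oddTriangles]
  | node u l r ihl ihr =>
    intro i j B hj hjN hB
    simp only [BinaryTree.numNodes] at hj
    obtain ⟨k, hk⟩ : ∃ k, i + l.numNodes + 1 = k := ⟨_, rfl⟩
    replace hj : k + r.numNodes + 1 = j := by omega
    have hTmem : triangle v i k j ∈ dissection v (.node u l r) i :=
      (mem_dissection_node u hk hj).mpr (Or.inl rfl)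
    have hLsub : dissection v l i ⊆ dissection v (.node u l r) i := fun s hs =>
      (mem_dissection_node u hk hj).mpr (Or.inr (Or.inl hs))
    have hRsub : dissection v r k ⊆ dissection v (.node u l r) i := fun s hs =>
      (mem_dissection_node u hk hj).mpr (Or.inr (Or.inr hs))
    have hl := ihl i k _ hk (by omega) (hB.inter hLsub)
    have hr := ihr k j _ hj hjN (hB.inter hRsub)
    have hBmem : ∀ s, s ∈ B ↔ (s = triangle v i k j ∧ triangle v i k j ∈ B) ∨
        s ∈ B ∩ dissection v l i ∨ s ∈ B ∩ dissection v r k := by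
      intro s
      simp only [Finset.mem_inter]
      constructor
      · intro hs
        rcases (mem_dissection_node u hk hj).mp (hB.1 hs) with rfl | h | h
        · exact Or.inl ⟨rfl, hs⟩
        · exact Or.inr (Or.inl ⟨hs, h⟩)
        · exact Or.inr (Or.inr ⟨hs, h⟩)
      · rintro (⟨rfl, h⟩ | h | h)
        · exact h
        · exact h.1
        · exact h.1
    have hadjL : ∀ s ∈ dissection v l i, v i ∈ s → v k ∈ s → (triangle v i k j ∈ B ↔ s ∉ B) :=
      fun s hs h1 h2 => hB.2 _ hTmem s (hLsub hs)
        ((edgeAdjacent_left_iff hv hk (by omega) hjN hs).mpr ⟨h1, h2⟩)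
    have hadjR : ∀ s ∈ dissection v r k, v k ∈ s → v j ∈ s → (triangle v i k j ∈ B ↔ s ∉ B) :=
      fun s hs h1 h2 => hB.2 _ hTmem s (hRsub hs)
        ((edgeAdjacent_right_iff hv (by omega) hj hjN hs).mpr ⟨h1, h2⟩)
    constructor
    · intro h
      have hT := h _ hTmem (by simp [triangle]) (by simp [triangle])
      have hl' := hl.2 fun s hs h1 h2 h3 =>
        (hadjL s hs h1 h2).mp hT (Finset.mem_inter.mp h3).1
      have hr' := hr.2 fun s hs h1 h2 h3 =>
        (hadjR s hs h1 h2).mp hT (Finset.mem_inter.mp h3).1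
      ext s
      rw [hBmem, hl', hr', mem_evenTriangles_node u hk hj]
      simp [hT]
    · intro h
      have hT := h _ hTmem (by simp [triangle]) (by simp [triangle])
      have hl' := hl.1 fun s hs h1 h2 => Finset.mem_inter.mpr
        ⟨not_not.mp fun h3 => hT ((hadjL s hs h1 h2).mpr h3), hs⟩
      have hr' := hr.1 fun s hs h1 h2 => Finset.mem_inter.mpr
        ⟨not_not.mp fun h3 => hT ((hadjR s hs h1 h2).mpr h3), hs⟩
      ext s
      rw [hBmem, hl', hr', mem_oddTriangles_node u hk]
      simp [hT]

theorem IsColouring.eq_or_eq (hv : IsCounterclockwise v N) {t : BinaryTree Unit} {i : ℕ}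
    (hi : i + t.numNodes + 1 ≤ N) {B : Finset (Finset Plane)}
    (hB : IsColouring (dissection v t i) B) :
    B = evenTriangles v t i ∨ B = oddTriangles v t i := by
  have h := IsColouring.eq_of_root hv t i _ B rfl hi hB
  cases t with
  | nil => exact Or.inl (h.1 (by simp [dissection_nil]))
  | node u l r =>
    have hroot : ∀ s ∈ dissection v (.node u l r) i, v i ∈ s →
        v (i + (BinaryTree.node u l r).numNodes + 1) ∈ s →
        s = triangle v i (i + l.numNodes + 1) (i + l.numNodes + 1 + r.numNodes + 1) := by
      intro s hs h1 h2
      simp only [BinaryTree.numNodes] at hi h2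
      refine eq_triangle_of_mem_of_mem hv u rfl rfl (by omega) hs h1 ?_
      convert h2 using 2
      omega
    by_cases hT : triangle v i (i + l.numNodes + 1) (i + l.numNodes + 1 + r.numNodes + 1) ∈ B
    · exact Or.inl (h.1 fun s hs h1 h2 => hroot s hs h1 h2 ▸ hT)
    · exact Or.inr (h.2 fun s hs h1 h2 => hroot s hs h1 h2 ▸ hT)

open Classical in
theorem dissection_sdiff_evenTriangles (hv : IsCounterclockwise v N) {t : BinaryTree Unit} {i : ℕ}
    (hi : i + t.numNodes + 1 ≤ N) :
    dissection v t i \ evenTriangles v t i = oddTriangles v t i :=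
  Finset.union_sdiff_cancel_left (disjoint_evenTriangles_oddTriangles hv t i hi)

open Classical in
theorem dissection_sdiff_oddTriangles (hv : IsCounterclockwise v N) {t : BinaryTree Unit} {i : ℕ}
    (hi : i + t.numNodes + 1 ≤ N) :
    dissection v t i \ oddTriangles v t i = evenTriangles v t i :=
  Finset.union_sdiff_cancel_right (disjoint_evenTriangles_oddTriangles hv t i hi)

theorem isFair_dissection_iff (hv : IsCounterclockwise v N) {t : BinaryTree Unit} {i : ℕ}
    (hi : i + t.numNodes + 1 ≤ N) : IsFair (dissection v t i) ↔ evenNodes t = oddNodes t := by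
  classical
  have hcol := isColouring_evenTriangles hv t i hi
  obtain ⟨he, ho⟩ := card_triangles hv t i hi
  have h1 := dissection_sdiff_evenTriangles hv hi
  have h2 := dissection_sdiff_oddTriangles hv hi
  constructor
  · rintro ⟨_, h⟩
    have := h _ hcol
    rwa [h1, he, ho] at this
  · intro h
    refine ⟨⟨_, hcol⟩, fun B hB => ?_⟩
    rcases hB.eq_or_eq hv hi with rfl | rfl
    · rw [h1, he, ho, h]
    · rw [h2, he, ho, h]

end Colouring

end Dissection

-- Counterclockwise enumeration of the vertices

section Parametrization

variable {v : ℕ → Plane} {N : ℕ}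

theorem notMem_convexHull_of_convexIndependent {V : Finset Plane}
    (hV : ConvexIndependent ℝ ((↑) : V → Plane)) {x : Plane} (hx : x ∈ V) {S : Set Plane}
    (hS : S ⊆ (V : Set Plane)) (hxS : x ∉ S) : x ∉ convexHull ℝ S := by
  have h := convexIndependent_set_iff_notMem_convexHull_sdiff (𝕜 := ℝ) (s := (V : Set Plane))
  intro hmem
  have hsub : S ⊆ (V : Set Plane) \ {x} := fun y hy => ⟨hS hy, fun hyx => hxS (hyx ▸ hy)⟩
  exact h.mp hV x hx (convexHull_mono hsub hmem)

theorem continuousLinearMap_apply_eq (f : Plane →L[ℝ] ℝ) (x : Plane) :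
    f x = x 0 * f !₂[1, 0] + x 1 * f !₂[0, 1] := by
  have : x = x 0 • (!₂[1, 0] : Plane) + x 1 • (!₂[0, 1] : Plane) := by
    ext i; fin_cases i <;> simp
  conv_lhs => rw [this]
  simp

/-- If `a`, `p`, `q` were collinear, `p` and `q` would be on the same side of `a` because `f` is
larger at both, so one would lie on the segment from `a` to the other. -/
theorem cross_ne_zero_of_convexIndependent {V : Finset Plane}
    (hV : ConvexIndependent ℝ ((↑) : V → Plane)) {f : Plane →L[ℝ] ℝ} {a p q : Plane}
    (ha : a ∈ V) (hp : p ∈ V) (hq : q ∈ V) (hpq : p ≠ q) (hfp : f a < f p) (hfq : f a < f q) :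
    cross a p q ≠ 0 := by
  intro h
  have hz : (f q - f a) • (p - a) = (f p - f a) • (q - a) := by
    have h' := h
    rw [cross] at h'
    rw [continuousLinearMap_apply_eq f q, continuousLinearMap_apply_eq f p,
      continuousLinearMap_apply_eq f a]
    ext i
    fin_cases i
    · simp only [PiLp.smul_apply, PiLp.sub_apply, smul_eq_mul, Fin.zero_eta]
      linear_combination f !₂[0, 1] * h'
    · simp only [PiLp.smul_apply, PiLp.sub_apply, smul_eq_mul, Fin.mk_one]
      linear_combination -f !₂[1, 0] * h'
  have key : ∀ p q : Plane, p ∈ V → q ∈ V → p ≠ q → f a < f p → f p ≤ f q →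
      (f q - f a) • (p - a) = (f p - f a) • (q - a) → False := by
    intro p q hp hq hpq hfp hle hz
    have hpos : 0 < f q - f a := by linarith
    have hmem : p ∈ convexHull ℝ ({a, q} : Set Plane) := by
      rw [convexHull_pair]
      refine ⟨1 - (f p - f a) / (f q - f a), (f p - f a) / (f q - f a), ?_, ?_, by ring, ?_⟩
      · rw [sub_nonneg, div_le_one hpos]; linarith
      · exact div_nonneg (by linarith) hpos.le
      · have h1 : p - a = ((f p - f a) / (f q - f a)) • (q - a) := by
          rw [div_eq_inv_mul, mul_smul, ← hz, smul_smul, inv_mul_cancel₀ hpos.ne', one_smul]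
        rw [← sub_eq_zero] at h1 ⊢
        rw [← neg_eq_zero, ← h1]
        module
    refine notMem_convexHull_of_convexIndependent hV hp ?_ ?_ hmem
    · rintro y (rfl | rfl) <;> assumption
    · rintro (rfl | rfl)
      · exact lt_irrefl _ hfp
      · exact hpq rfl
  rcases le_total (f p) (f q) with hle | hle
  · exact key p q hp hq hpq hfp hle hz
  · exact key q p hq hp hpq.symm hfq hle hz.symm

/-- The vertices of a strictly convex polygon can be enumerated counterclockwise, starting at any
vertex. -/
theorem exists_isCounterclockwise {V : Finset Plane}
    (hV : ConvexIndependent ℝ ((↑) : V → Plane)) (hN : #V = N + 1) (hN1 : 1 ≤ N) {a : Plane}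
    (ha : a ∈ V) : ∃ v, IsCounterclockwise v N ∧ v 0 = a ∧ arc v 0 N = V := by
  classical
  -- Seen from `a`, all other vertices lie in an open half-plane, so their directions are linearly
  -- ordered by angle.
  obtain ⟨f, u, hfa, hfu⟩ := geometric_hahn_banach_point_closed
    (convex_convexHull ℝ ((V.erase a : Finset Plane) : Set Plane))
    ((V.erase a).finite_toSet.isCompact_convexHull (𝕜 := ℝ)).isClosed
    (notMem_convexHull_of_convexIndependent hV ha
      (Finset.coe_subset.mpr (Finset.erase_subset a V)) (by simp))
  have hf : ∀ q ∈ V.erase a, f a < f q := fun q hq =>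
    hfa.trans (hfu q (subset_convexHull ℝ _ hq))
  have hcardW : #(V.erase a) = N := by rw [Finset.card_erase_of_mem ha, hN]; rfl
  obtain ⟨c, hc⟩ : (V.erase a).Nonempty := Finset.card_pos.mp (by omega)
  -- A slope of the direction from `a` to `q`, with `c` as reference. By `hsub`, a difference of
  -- slopes has the sign of `cross a p q`, so increasing slope is counterclockwise order around `a`.
  set slope : Plane → ℝ := fun q => cross a c q / (f q - f a) with hslope
  have hsub : ∀ p ∈ V.erase a, ∀ q ∈ V.erase a, slope q - slope p =
      cross a p q * ((f c - f a) / ((f p - f a) * (f q - f a))) := by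
    intro p hp q hq
    have h1 : f p - f a ≠ 0 := (sub_pos.mpr (hf p hp)).ne'
    have h2 : f q - f a ≠ 0 := (sub_pos.mpr (hf q hq)).ne'
    simp only [hslope]
    field_simp
    rw [continuousLinearMap_apply_eq f q, continuousLinearMap_apply_eq f p,
      continuousLinearMap_apply_eq f a, continuousLinearMap_apply_eq f c]
    simp only [cross]
    ring
  have hfac : ∀ p ∈ V.erase a, ∀ q ∈ V.erase a,
      0 < (f c - f a) / ((f p - f a) * (f q - f a)) := fun p hp q hq =>
    div_pos (sub_pos.mpr (hf c hc)) (mul_pos (sub_pos.mpr (hf p hp)) (sub_pos.mpr (hf q hq)))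
  have hinj : Set.InjOn slope (V.erase a) := by
    intro p hp q hq h
    by_contra hne
    have h1 := hsub p hp q hq
    rw [h, sub_self] at h1
    exact (mul_ne_zero (cross_ne_zero_of_convexIndependent hV ha (Finset.mem_of_mem_erase hp)
      (Finset.mem_of_mem_erase hq) hne (hf p hp) (hf q hq)) (hfac p hp q hq).ne') h1.symm
  have hcardS : #((V.erase a).image slope) = N := by
    rw [Finset.card_image_of_injOn hinj, hcardW]
  have hex : ∀ i : Fin N, ∃ q ∈ V.erase a,
      slope q = ((V.erase a).image slope).orderEmbOfFin hcardS i := fun i =>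
    Finset.mem_image.mp (Finset.orderEmbOfFin_mem _ hcardS i)
  choose w hwmem hw using hex
  let v : ℕ → Plane := fun i => if h : i - 1 < N ∧ i ≠ 0 then w ⟨i - 1, h.1⟩ else a
  have hv0 : v 0 = a := by simp [v]
  have hvs : ∀ i : Fin N, v (i + 1) = w i := by intro i; simp [v]
  have hvpos : ∀ i, 0 < i → i ≤ N → ∃ l : Fin N, v i = w l ∧ (l : ℕ) + 1 = i := by
    intro i hi hiN
    exact ⟨⟨i - 1, by omega⟩, by rw [← hvs]; congr 1; simp; omega, by simp; omega⟩
  have hcross0 : ∀ i j, 0 < i → i < j → j ≤ N → 0 < cross a (v i) (v j) := by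
    intro i j hi hij hj
    obtain ⟨l, hl, hl'⟩ := hvpos i hi (by omega)
    obtain ⟨m, hm, hm'⟩ := hvpos j (by omega) hj
    rw [hl, hm]
    have h1 := hsub _ (hwmem l) _ (hwmem m)
    have h2 : 0 < slope (w m) - slope (w l) := by
      rw [hw, hw, sub_pos]
      exact (Finset.orderEmbOfFin _ hcardS).strictMono (by rw [Fin.lt_def]; omega)
    rw [h1] at h2
    exact pos_of_mul_pos_left h2 (hfac _ (hwmem l) _ (hwmem m)).le
  have hvV : ∀ i, 0 < i → i ≤ N → v i ∈ V.erase a := by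
    intro i hi hiN
    obtain ⟨l, hl, _⟩ := hvpos i hi hiN
    rw [hl]
    exact hwmem l
  refine ⟨v, ?_, hv0, ?_⟩
  · intro i j k hij hjk hk
    rcases Nat.eq_zero_or_pos i with rfl | hi
    · rw [hv0]
      exact hcross0 j k hij hjk hk
    -- Otherwise `v j` would lie in the triangle `a, v i, v k`, against convex independence.
    by_contra hneg
    have h1 := hcross0 i j hi hij (by omega)
    have h2 := hcross0 j k (by omega) hjk hk
    have h3 := hcross0 i k hi (by omega) hk
    have hmem := mem_convexHull_triangle (x := v j) h3 h1.le
      (by rw [← cross_rotate, cross_rotate, ← cross_rotate, cross_swap, cross_rotate]; linarith)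
      (by rw [← cross_rotate]; exact h2.le)
    refine notMem_convexHull_of_convexIndependent hV
      (Finset.mem_of_mem_erase (hvV j (by omega) (by omega))) ?_ ?_ hmem
    · rintro y (rfl | rfl | rfl)
      · exact ha
      · exact Finset.mem_of_mem_erase (hvV i hi (by omega))
      · exact Finset.mem_of_mem_erase (hvV k (by omega) hk)
    · rintro (h | h | h)
      · exact Finset.ne_of_mem_erase (hvV j (by omega) (by omega)) h
      · rw [h, cross_self_right] at h1; exact lt_irrefl _ h1
      · rw [h, cross_self_right] at h2; exact lt_irrefl _ h2
  · ext q
    rw [mem_arc]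
    constructor
    · rintro ⟨l, _, hl, rfl⟩
      rcases Nat.eq_zero_or_pos l with rfl | hl0
      · rwa [hv0]
      · exact Finset.mem_of_mem_erase (hvV l hl0 hl)
    · intro hq
      by_cases hqa : q = a
      · exact ⟨0, le_rfl, Nat.zero_le _, hv0.trans hqa.symm⟩
      have hqW : q ∈ V.erase a := Finset.mem_erase.mpr ⟨hqa, hq⟩
      have hmem : slope q ∈ Set.range (((V.erase a).image slope).orderEmbOfFin hcardS) := by
        rw [Finset.range_orderEmbOfFin]
        exact Finset.mem_coe.mpr (Finset.mem_image_of_mem _ hqW)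
      obtain ⟨i, hi⟩ := hmem
      rw [← hw] at hi
      exact ⟨i + 1, Nat.zero_le _, i.2, (hvs i).trans (hinj (hwmem i) hqW hi)⟩

/-- A chord of a convex polygon which is not an edge meets the interior. -/
theorem IsCounterclockwise.midpoint_mem_interior (hv : IsCounterclockwise v N) {k : ℕ}
    (hk1 : 1 < k) (hkN : k < N) :
    (1 / 2 : ℝ) • v 0 + (1 / 2 : ℝ) • v k ∈ interior (convexHull ℝ (arc v 0 N : Set Plane)) := by
  have hopen : IsOpen ((⋂ m ∈ Finset.range N, {x | 0 < cross (v m) (v (m + 1)) x}) ∩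
      {x | 0 < cross (v N) (v 0) x}) :=
    (isOpen_biInter_finset fun m _ => isOpen_lt continuous_const (continuous_cross _ _)).inter
      (isOpen_lt continuous_const (continuous_cross _ _))
  refine interior_maximal ?_ hopen ?_
  · rintro x ⟨hx, hx'⟩
    simp only [Set.mem_iInter, Finset.mem_range] at hx
    exact hv.mem_convexHull_arc (by omega) le_rfl (fun m _ hm => (hx m hm).le) (le_of_lt hx')
  · simp only [Set.mem_inter_iff, Set.mem_iInter, Finset.mem_range, Set.mem_ofPred_eq]
    constructor
    · intro m hm
      rw [cross_combo _ _ _ _ (by norm_num)]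
      have h1 : 0 ≤ cross (v m) (v (m + 1)) (v 0) := by
        rw [cross_rotate]; exact hv.cross_nonneg (Nat.zero_le _) (by omega) (by omega)
      have h2 : 0 ≤ cross (v m) (v (m + 1)) (v k) :=
        hv.cross_edge_nonneg (i := 0) le_rfl hm
          (subset_convexHull ℝ _ (apply_mem_arc (Nat.zero_le _) hkN.le))
      -- Strictness comes from `v 0`, except at the edge from `v 0` to `v 1`, where it comes from `v
      -- k` as `1 < k`.
      rcases Nat.eq_zero_or_pos m with rfl | hm0
      · have := hv 0 1 k (by omega) hk1 hkN.le
        rw [zero_add] at h1 ⊢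
        linarith
      · have h3 : 0 < cross (v m) (v (m + 1)) (v 0) := by
          rw [cross_rotate]; exact hv 0 m (m + 1) hm0 (by omega) (by omega)
        linarith
    · rw [cross_combo _ _ _ _ (by norm_num), cross_self_right, ← cross_rotate]
      have := hv 0 k N (by omega) hkN le_rfl
      linarith

/-- The vertices of a strictly convex polygon can be enumerated counterclockwise such that a given
edge joins the last and the first vertex. -/
theorem IsEdge.exists_isCounterclockwise {V e : Finset Plane} (he : IsEdge V e)
    (hV : ConvexIndependent ℝ ((↑) : V → Plane)) (hN : #V = N + 1) (hN1 : 1 ≤ N) :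
    ∃ v, IsCounterclockwise v N ∧ arc v 0 N = V ∧ ∀ s : Finset Plane, e ⊆ s ↔ v 0 ∈ s ∧ v N ∈ s := by
  classical
  obtain ⟨hsub, hcard, hfr⟩ := he
  obtain ⟨a, b, hab, rfl⟩ := Finset.card_eq_two.mp hcard
  obtain ⟨v, hv, hv0, harc⟩ :=
    FairTriangulation.exists_isCounterclockwise hV hN hN1 (hsub (by simp : a ∈ _))
  obtain ⟨k, -, hkN, hk⟩ := mem_arc.mp (harc.symm ▸ hsub (by simp : b ∈ _))
  have hk0 : k ≠ 0 := by
    rintro rfl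
    exact hab (hv0.symm.trans hk)
  -- Starting the enumeration at `a`, the other endpoint `b = v k` must be a neighbour: for `1 < k <
  -- N` the chord meets the interior, whereas an edge lies in the frontier.
  rcases hkN.eq_or_lt with rfl | hlt
  · refine ⟨v, hv, harc, fun s => ?_⟩
    rw [hv0, hk]
    simp [Finset.insert_subset_iff]
  rcases Nat.lt_or_ge 1 k with h1 | h1
  · exfalso
    have hmem := hv.midpoint_mem_interior h1 hlt
    rw [harc] at hmem
    refine (hfr ?_).2 hmem
    rw [hv0, hk]
    exact convex_convexHull ℝ _ (subset_convexHull ℝ _ (by simp)) (subset_convexHull ℝ _ (by simp))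
      (by norm_num) (by norm_num) (by norm_num)
  · obtain rfl : k = 1 := by omega
    -- Cyclic shift by one, making `b` the first and `a` the last vertex.
    refine ⟨fun i => if i < N then v (i + 1) else v 0, ?_, ?_, fun s => ?_⟩
    · intro i j k hij hjk hkN
      simp only [show i < N by omega, show j < N by omega, if_true]
      split_ifs with h
      · exact hv _ _ _ (by omega) (by omega) (by omega)
      · rw [cross_rotate]
        exact hv _ _ _ (by omega) (by omega) (by omega)
    · rw [← harc]
      ext q
      simp only [mem_arc]
      constructor
      · rintro ⟨l, _, hl, rfl⟩
        split_ifs with h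
        · exact ⟨l + 1, Nat.zero_le _, h, rfl⟩
        · exact ⟨0, le_rfl, Nat.zero_le _, rfl⟩
      · rintro ⟨l, _, hl, rfl⟩
        rcases Nat.eq_zero_or_pos l with rfl | hl0
        · exact ⟨N, Nat.zero_le _, le_rfl, by simp⟩
        · exact ⟨l - 1, Nat.zero_le _, by omega, by
            rw [if_pos (by omega), Nat.sub_add_cancel hl0]⟩
    · simp only [show 0 < N by omega, if_true, lt_irrefl, if_false, zero_add]
      rw [hv0, hk]
      simp [Finset.insert_subset_iff, and_comm]

end Parametrization

-- Transfer of the counts to trees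

section Count

open BinaryTree

variable {v : ℕ → Plane} {n : ℕ}

theorem card_fairTriangulations_arc (hv : IsCounterclockwise v (2 * n + 1)) :
    #(fairTriangulations (arc v 0 (2 * n + 1))) = #(bicolouredTrees n n) := by
  classical
  have himage : fairTriangulations (arc v 0 (2 * n + 1)) =
      (bicolouredTrees n n).image fun t => dissection v t 0 := by
    ext τ
    have h := isTriangulation_arc_iff_exists_tree hv (2 * n) 0 (by omega) τ
    rw [zero_add] at h
    simp only [fairTriangulations, triangulations, Finset.mem_filter, Finset.mem_powerset,
      Finset.mem_image, mem_bicolouredTrees, h]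
    constructor
    · rintro ⟨⟨_, t, ht, rfl⟩, hfair⟩
      rw [isFair_dissection_iff hv (by omega)] at hfair
      have := evenNodes_add_oddNodes t
      exact ⟨t, by omega, rfl⟩
    · rintro ⟨t, ht, rfl⟩
      have hnum := evenNodes_add_oddNodes t
      refine ⟨⟨fun s hs => ?_, t, by omega, rfl⟩, ?_⟩
      · exact Finset.mem_powerset.mpr (subset_arc_of_mem_dissection hv (by omega) le_rfl hs)
      · rw [isFair_dissection_iff hv (by omega)]
        omega
  rw [himage, Finset.card_image_of_injOn]
  intro t ht t' ht' h
  simp only [Finset.mem_coe, mem_bicolouredTrees] at ht ht'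
  have h1 := evenNodes_add_oddNodes t
  have h2 := evenNodes_add_oddNodes t'
  exact dissection_injective hv t t' 0 (by omega) (by omega) h

/-- The condition `he` makes the triangle on the marked edge the root triangle; requiring it to be
black selects the even-depth colouring, so each tree contributes exactly one term. -/
theorem w_arc_eq_sum (hv : IsCounterclockwise v (2 * n + 1)) {e : Finset Plane}
    (he : ∀ s : Finset Plane, e ⊆ s ↔ v 0 ∈ s ∧ v (2 * n + 1) ∈ s) :
    w (arc v 0 (2 * n + 1)) e = ∑ t ∈ treesOfNumNodesEq (2 * n),
      LaurentPolynomial.T ((evenNodes t : ℤ) - oddNodes t) := by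
  classical
  have himage : checkerboardTriangulations (arc v 0 (2 * n + 1)) e =
      (treesOfNumNodesEq (2 * n)).image fun t => (dissection v t 0, evenTriangles v t 0) := by
    ext ⟨τ, B⟩
    have h := isTriangulation_arc_iff_exists_tree hv (2 * n) 0 (by omega) τ
    rw [zero_add] at h
    simp only [checkerboardTriangulations, triangulations, Finset.mem_filter, Finset.mem_product,
      Finset.mem_powerset, Finset.mem_image, mem_treesOfNumNodesEq, Prod.mk.injEq, h, he]
    constructor
    · rintro ⟨⟨⟨_, t, ht, rfl⟩, _⟩, hcol, hroot⟩
      exact ⟨t, ht, rfl, ((hcol.eq_of_root hv t 0 _ B (by omega) le_rfl).1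
        fun s hs h1 h2 => hroot s hs ⟨h1, h2⟩).symm⟩
    · rintro ⟨t, ht, rfl, rfl⟩
      have hsub : dissection v t 0 ⊆ (arc v 0 (2 * n + 1)).powerset := fun s hs =>
        Finset.mem_powerset.mpr (subset_arc_of_mem_dissection hv (by omega) le_rfl hs)
      exact ⟨⟨⟨hsub, t, ht, rfl⟩, (evenTriangles_subset t 0).trans hsub⟩,
        isColouring_evenTriangles hv t 0 (by omega), fun s hs h1 =>
          mem_evenTriangles_of_mem_of_mem hv (by omega) le_rfl hs h1.1 h1.2⟩
  rw [w, himage, Finset.sum_image]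
  · refine Finset.sum_congr rfl fun t ht => ?_
    rw [mem_treesOfNumNodesEq] at ht
    obtain ⟨h1, h2⟩ := card_triangles hv t 0 (by omega)
    have h3 := dissection_sdiff_evenTriangles hv (t := t) (i := 0) (by omega)
    simp only
    rw [h1, h3, h2]
  · intro t ht t' ht' h
    simp only [Finset.mem_coe, mem_treesOfNumNodesEq] at ht ht'
    exact dissection_injective hv t t' 0 (by omega) (by omega) (Prod.mk.inj h).1

theorem coeff_zero_sum_T (n : ℕ) :
    (∑ t ∈ treesOfNumNodesEq (2 * n),
      LaurentPolynomial.T ((evenNodes t : ℤ) - oddNodes t) : ℕ[T;T⁻¹]).coeff 0 =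
      #(bicolouredTrees n n) := by
  have hT : ∀ m : ℤ, (LaurentPolynomial.T m : ℕ[T;T⁻¹]).coeff 0 = if m = 0 then 1 else 0 := by
    intro m
    rw [LaurentPolynomial.T, AddMonoidAlgebra.coeff_single, Finsupp.single_apply]
  have hfilter : bicolouredTrees n n =
      {t ∈ treesOfNumNodesEq (2 * n) | (evenNodes t : ℤ) - oddNodes t = 0} := by
    ext t
    have := evenNodes_add_oddNodes t
    rw [mem_bicolouredTrees, Finset.mem_filter, mem_treesOfNumNodesEq]
    omega
  rw [hfilter, Finset.card_filter]
  simp [AddMonoidAlgebra.coeff_sum, Finsupp.finsetSum_apply, hT]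

end Count

end FairTriangulation

theorem theorem1 (n : ℕ) (V : Finset FairTriangulation.Plane)
    (hV : FairTriangulation.IsStrictlyConvexPolygon V) (hcard : V.card = 2 * n + 2) :
    ((FairTriangulation.fairTriangulations V).card : ℚ)
        = ((2 * n).choose n : ℚ) ^ 2 / ((n : ℚ) + 1) ∧
    ∀ e : Finset FairTriangulation.Plane, FairTriangulation.IsEdge V e →
      (FairTriangulation.w V e).coeff 0 = (FairTriangulation.fairTriangulations V).card := by
  constructor
  -- Fairness does not depend on the choice of root edge, so the enumeration may start at any
  -- vertex.
  · obtain ⟨a, ha⟩ : V.Nonempty := Finset.card_pos.mp (by omega)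
    obtain ⟨v, hv, -, rfl⟩ :=
      FairTriangulation.exists_isCounterclockwise (N := 2 * n + 1) hV.2 hcard (by omega) ha
    rw [FairTriangulation.card_fairTriangulations_arc hv,
      FairTriangulation.card_bicolouredTrees_self]
  · intro e he
    obtain ⟨v, hv, rfl, hroot⟩ :=
      he.exists_isCounterclockwise (N := 2 * n + 1) hV.2 hcard (by omega)
    rw [FairTriangulation.w_arc_eq_sum hv hroot, FairTriangulation.coeff_zero_sum_T,
      FairTriangulation.card_fairTriangulations_arc hv]
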